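/- Let $\mathcal A$ be a finite alphabet with $|\mathcal A|\ge 2$, let $\omega\in\mathcal A^{\mathbb Z}$, let $T$ be the shift $(Tx)_k=x_{k+1}$, let $\mathcal O_\omega=\overline{\{T^i\omega: i\in\mathbb Z\}}\subset\mathcal A^{\mathbb Z}$, and assume that $(\mathcal O_\omega,T)$ is a Cantor minimal system (that is, $\mathcal O_\omega$ is a Cantor space and every $T$-orbit in it is dense). Let $(E_{\mathbb Z},\mathcal L_\omega)$ be the labeled graph with vertices $v_n$ and edges $e_n$ from $v_n$ to $v_{n+1}$ labeled $\omega_n$ ($n\in\mathbb Z$). For a set $A$ of vertices and a word $\alpha$, let $r(A,\alpha)$ be the set of ranges of the paths with label $\alpha$ and source in $A$, and let $r(\alpha)=r(E_{\mathbb Z}^0,\alpha)$; let $L_\omega$ be the set of labels of paths of length $\geq 1$ (the factors of $\omega$). Let $\overline{\mathcal E}_{\mathbb Z}$ be the smallest collection of vertex sets that contains $\emptyset$ and $r(\alpha)$ for all $\alpha\in L_\omega$ and is closed under finite unions, finite intersections, relative complements and $A\mapsto r(A,\alpha)$, $\alpha\in L_\omega$. Let $C^*(E_{\mathbb Z},\mathcal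 L_\omega,\overline{\mathcal E}_{\mathbb Z})$ be the universal $C^*$-algebra generated by projections $p_A$ ($A\in\overline{\mathcal E}_{\mathbb Z}$) and partial isometries $s_a$ ($a\in\mathcal A$) such that, for all $A,B\in\overline{\mathcal E}_{\mathbb Z}$ and $a,b\in\mathcal A$, 1. $p_\emptyset=0$, $p_Ap_B=p_{A\cap B}$, $p_{A\cup B}=p_A+p_B-p_{A\cap B}$; 2. $p_As_a=s_ap_{r(A,a)}$; 3. $s_a^*s_a=p_{r(a)}$, and $s_a^*s_b=0$ if $a\ne b$; 4. $p_A=\sum_a s_ap_{r(A,a)}s_a^*$, the sum over the labels $a$ of the edges with source in $A$. Let $\gamma$ be the gauge action of the circle group $\mathbb T$, given by $\gamma_z(s_a)=zs_a$ and $\gamma_z(p_A)=p_A$, and let $C^*(E_{\mathbb Z},\mathcal L_\omega,\overline{\mathcal E}_{\mathbb Z})^\gamma$ be its fixed-point algebra. For $\alpha=\alpha_1\cdots\alpha_n$ put $s_\alpha=s_{\alpha_1}\cdots s_{\alpha_n}$. Then there is a surjective $*$-isomorphism $$\rho: C^*(E_{\mathbb Z},\mathcal L_\omega,\overline{\mathcal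 E}_{\mathbb Z})^\gamma\to C(\mathcal O_\omega)$$ such that for all $\alpha,\alpha'\in L_\omega$ the element $s_\alpha p_{r(\alpha'\alpha)}s_\alpha^*$ lies in the fixed-point algebra and $$\rho\big(s_\alpha p_{r(\alpha'\alpha)}s_\alpha^*\big)=\chi_{[\alpha'.\alpha]},$$ where $[\alpha'.\alpha]$ is the set of all $x\in\mathcal O_\omega$ with $x_{-|\alpha'|}\cdots x_{-1}=\alpha'$ and $x_0\cdots x_{|\alpha|-1}=\alpha$. -/

import Mathlib

open scoped ENNReal

universe u w

/-! ### Labeled graphs -/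

/-- A directed graph with vertex set `V` and edge set `E`, together with a labeling of its edges
by letters of the alphabet `𝓐`. -/
structure LabeledGraph (V E 𝓐 : Type*) where
  src : E → V
  tgt : E → V
  label : E → 𝓐

namespace LabeledGraph

variable {V E 𝓐 : Type*} (G : LabeledGraph V E 𝓐)

/-- `G.PathFrom v α x`: there is a finite path in the graph from `v` to `x` whose label is the
word `α`. The empty word labels exactly the paths of length zero. -/
inductive PathFrom : V → List 𝓐 → V → Prop
  | nil (v : V) : PathFrom v [] v
  | cons (e : E) {α : List 𝓐} {x : V} :
      PathFrom (G.tgt e) α x → PathFrom (G.src e) (G.label e :: α) x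

/-- The set `ℒ(E^{≥1})` of labeled paths: the labels of the paths of length at least one. -/
def labeledPaths : Set (List 𝓐) := {α | α ≠ [] ∧ ∃ v x, G.PathFrom v α x}

/-- The relative range `r(A, α)`. -/
def relRange (A : Set V) (α : List 𝓐) : Set V := {x | ∃ v ∈ A, G.PathFrom v α x}

/-- The range `r(α)`. -/
def range (α : List 𝓐) : Set V := G.relRange Set.univ α

/-- `ℒ(A E¹)`: the labels of the edges whose source lies in `A`. -/
def labelsFrom (A : Set V) : Set 𝓐 := {a | ∃ e, G.src e ∈ A ∧ G.label e = a}

/-- Normal accommodating sets: collections of vertex sets that contain the empty set and all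
ranges of labeled paths and are closed under relative ranges, finite unions, finite intersections
and relative complements. -/
structure IsNormalAccommodating (𝓑 : Set (Set V)) : Prop where
  empty_mem : ∅ ∈ 𝓑
  range_mem : ∀ α ∈ G.labeledPaths, G.range α ∈ 𝓑
  relRange_mem : ∀ A ∈ 𝓑, ∀ α ∈ G.labeledPaths, G.relRange A α ∈ 𝓑
  union_mem : ∀ A ∈ 𝓑, ∀ B ∈ 𝓑, A ∪ B ∈ 𝓑
  inter_mem : ∀ A ∈ 𝓑, ∀ B ∈ 𝓑, A ∩ B ∈ 𝓑
  diff_mem : ∀ A ∈ 𝓑, ∀ B ∈ 𝓑, A \ B ∈ 𝓑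

/-- The smallest normal accommodating set. -/
def Ebar : Set (Set V) := ⋂₀ {𝓑 | G.IsNormalAccommodating 𝓑}

theorem isNormalAccommodating_Ebar : G.IsNormalAccommodating G.Ebar where
  empty_mem := fun _ h => h.empty_mem
  range_mem := fun α hα _ h => h.range_mem α hα
  relRange_mem := fun A hA α hα _ h => h.relRange_mem A (hA _ h) α hα
  union_mem := fun A hA B hB _ h => h.union_mem A (hA _ h) B (hB _ h)
  inter_mem := fun A hA B hB _ h => h.inter_mem A (hA _ h) B (hB _ h)
  diff_mem := fun A hA B hB _ h => h.diff_mem A (hA _ h) B (hB _ h)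

theorem relRange_eq_empty {α : List 𝓐} (hα : α ≠ []) (h : α ∉ G.labeledPaths) (A : Set V) :
    G.relRange A α = ∅ := by
  ext x
  simp only [Set.mem_empty_iff_false, iff_false]
  rintro ⟨v, -, hv⟩
  exact h ⟨hα, v, x, hv⟩

theorem relRange_mem_Ebar {A : Set V} (hA : A ∈ G.Ebar) {α : List 𝓐} (hα : α ≠ []) :
    G.relRange A α ∈ G.Ebar := by
  by_cases h : α ∈ G.labeledPaths
  · exact G.isNormalAccommodating_Ebar.relRange_mem A hA α h
  · rw [G.relRange_eq_empty hα h]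
    exact G.isNormalAccommodating_Ebar.empty_mem

theorem range_mem_Ebar {α : List 𝓐} (hα : α ≠ []) : G.range α ∈ G.Ebar := by
  by_cases h : α ∈ G.labeledPaths
  · exact G.isNormalAccommodating_Ebar.range_mem α h
  · rw [range, G.relRange_eq_empty hα h]
    exact G.isNormalAccommodating_Ebar.empty_mem

/-! ### Representations of a labeled space and its universal C⋆-algebra -/

/-- A representation of the labeled space `(E, ℒ, Ē)` (over a finite alphabet) in a C⋆-algebra
`B`: projections `p A`, for `A` in the smallest normal accommodating set, and partial isometries
`s a`, for letters `a`, subject to the relations of Bates and Pask. -/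
structure Representation [Finite 𝓐] (B : Type*) [NonUnitalCStarAlgebra B] where
  p : G.Ebar → B
  s : 𝓐 → B
  isStarProjection_p : ∀ A, IsStarProjection (p A)
  partialIsometry_s : ∀ a, s a * star (s a) * s a = s a
  p_empty : p ⟨∅, G.isNormalAccommodating_Ebar.empty_mem⟩ = 0
  p_mul_p : ∀ A A' : G.Ebar,
    p A * p A' = p ⟨A ∩ A', G.isNormalAccommodating_Ebar.inter_mem _ A.2 _ A'.2⟩
  p_union : ∀ A A' : G.Ebar,
    p ⟨A ∪ A', G.isNormalAccommodating_Ebar.union_mem _ A.2 _ A'.2⟩ =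
      p A + p A' - p ⟨A ∩ A', G.isNormalAccommodating_Ebar.inter_mem _ A.2 _ A'.2⟩
  p_mul_s : ∀ (A : G.Ebar) (a : 𝓐),
    p A * s a = s a * p ⟨G.relRange A [a], G.relRange_mem_Ebar A.2 (List.cons_ne_nil a [])⟩
  star_s_mul_s : ∀ a, star (s a) * s a = p ⟨G.range [a], G.range_mem_Ebar (List.cons_ne_nil a [])⟩
  star_s_mul_s_of_ne : ∀ a b, a ≠ b → star (s a) * s b = 0
  p_eq_sum : ∀ A : G.Ebar, p A = ∑ a ∈ (Set.toFinite (G.labelsFrom A)).toFinset,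
    s a * p ⟨G.relRange A [a], G.relRange_mem_Ebar A.2 (List.cons_ne_nil a [])⟩ * star (s a)

namespace Representation

variable {G} [Finite 𝓐] {B : Type*} [NonUnitalCStarAlgebra B]

theorem norm_p_le (π : G.Representation B) (A : G.Ebar) : ‖π.p A‖ ≤ 1 :=
  (π.isStarProjection_p A).norm_le

theorem norm_s_le (π : G.Representation B) (a : 𝓐) : ‖π.s a‖ ≤ 1 := by
  have h := CStarRing.norm_star_mul_self (x := π.s a)
  rw [π.star_s_mul_s] at h
  nlinarith [π.norm_p_le ⟨G.range [a], G.range_mem_Ebar (List.cons_ne_nil a [])⟩,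
    norm_nonneg (π.s a)]

/-- The representation with `s a` replaced by `z • s a`, for `z` in the unit circle. -/
noncomputable def twist (z : Circle) (π : G.Representation B) : G.Representation B :=
  have hz : star (z : ℂ) * (z : ℂ) = 1 := by
    rw [← starRingEnd_apply, Complex.conj_mul', Circle.norm_coe, Complex.ofReal_one, one_pow]
  { p := π.p
    s := fun a => (z : ℂ) • π.s a
    isStarProjection_p := π.isStarProjection_p
    partialIsometry_s := fun a => by
      simp only [star_smul, smul_mul_assoc, mul_smul_comm, smul_smul]
      rw [π.partialIsometry_s, hz, mul_one]
    p_empty := π.p_empty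
    p_mul_p := π.p_mul_p
    p_union := π.p_union
    p_mul_s := fun A a => by
      rw [mul_smul_comm, smul_mul_assoc, π.p_mul_s]
    star_s_mul_s := fun a => by
      rw [star_smul, smul_mul_assoc, mul_smul_comm, smul_smul, hz, one_smul, π.star_s_mul_s]
    star_s_mul_s_of_ne := fun a b hab => by
      rw [star_smul, smul_mul_assoc, mul_smul_comm, π.star_s_mul_s_of_ne a b hab, smul_zero,
        smul_zero]
    p_eq_sum := fun A => by
      simp only [star_smul, smul_mul_assoc, mul_smul_comm, smul_smul]
      rw [hz]
      simp only [one_smul]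
      exact π.p_eq_sum A }

end Representation

variable [Finite 𝓐]

/-- All representations of the labeled space in C⋆-algebras of the universe `w`. -/
structure AnyRepresentation where
  algebra : Type w
  [inst : NonUnitalCStarAlgebra algebra]
  rep : G.Representation algebra

attribute [instance] AnyRepresentation.inst

/-- The C⋆-algebra of all bounded families, indexed by the representations `π` of the labeled
space, whose `π`-th member lies in the C⋆-algebra in which `π` takes its values. -/
abbrev BoundedFamilies : Type _ := lp (fun π : AnyRepresentation.{w} G => π.algebra) ∞

/-- The family `(π.s a)_π`. -/
noncomputable def famS (a : 𝓐) : BoundedFamilies.{w} G :=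
  ⟨fun π => π.rep.s a, memℓp_infty ⟨1, by rintro _ ⟨π, rfl⟩; exact π.rep.norm_s_le a⟩⟩

/-- The family `(π.p A)_π`. -/
noncomputable def famP (A : G.Ebar) : BoundedFamilies.{w} G :=
  ⟨fun π => π.rep.p A, memℓp_infty ⟨1, by rintro _ ⟨π, rfl⟩; exact π.rep.norm_p_le A⟩⟩

/-- The ⋆-algebra generated by the families `(π.s a)_π` and `(π.p A)_π`. -/
noncomputable def genAlgebra : NonUnitalStarSubalgebra ℂ (BoundedFamilies.{w} G) :=
  NonUnitalStarAlgebra.adjoin ℂ (Set.range (famS.{w} G) ∪ Set.range (famP.{w} G))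

/-- The labeled graph C⋆-algebra `C*(E, ℒ, Ē)`: the C⋆-algebra generated by the universal
representation, realized as the direct sum of all representations. -/
noncomputable def cstarSubalgebra : NonUnitalStarSubalgebra ℂ (BoundedFamilies.{w} G) :=
  (genAlgebra.{w} G).topologicalClosure

instance : IsClosed (cstarSubalgebra.{w} G : Set (BoundedFamilies.{w} G)) :=
  (genAlgebra.{w} G).isClosed_topologicalClosure

/-- The labeled graph C⋆-algebra as a type. -/
abbrev CStar : Type _ := cstarSubalgebra.{w} G

/-- The universal partial isometries. -/
noncomputable def uS (a : 𝓐) : CStar.{w} G :=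
  ⟨famS G a, (genAlgebra G).le_topologicalClosure
    (NonUnitalStarAlgebra.subset_adjoin ℂ _ (Or.inl ⟨a, rfl⟩))⟩

/-- The universal projections. -/
noncomputable def uP (A : G.Ebar) : CStar.{w} G :=
  ⟨famP G A, (genAlgebra G).le_topologicalClosure
    (NonUnitalStarAlgebra.subset_adjoin ℂ _ (Or.inr ⟨A, rfl⟩))⟩

/-- `s_α = s_{α₁} ⋯ s_{αₙ}` for a word `α = α₁ ⋯ αₙ` of length `n ≥ 1`; the value at the empty
word is a dummy. -/
noncomputable def uSWord : List 𝓐 → CStar.{w} G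
  | [] => 0
  | [a] => G.uS a
  | a :: b :: α => G.uS a * uSWord (b :: α)

theorem coe_finsetSum_apply {ι : Type*} (t : Finset ι) (f : ι → CStar.{w} G)
    (π : AnyRepresentation.{w} G) :
    (((∑ i ∈ t, f i : CStar.{w} G) : BoundedFamilies.{w} G)) π =
      ∑ i ∈ t, ((f i : BoundedFamilies.{w} G)) π := by
  classical
  induction t using Finset.induction_on with
  | empty => simp only [Finset.sum_empty]; rfl
  | insert i t hi ih => rw [Finset.sum_insert hi, Finset.sum_insert hi, ← ih]; rfl

/-- The generators of the labeled graph C⋆-algebra form a representation of the labeled space. -/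
noncomputable def universalRep : G.Representation (CStar.{w} G) where
  p := G.uP
  s := G.uS
  isStarProjection_p A :=
    ⟨Subtype.ext (lp.ext (funext fun π => (π.rep.isStarProjection_p A).isIdempotentElem)),
      Subtype.ext (lp.ext (funext fun π => (π.rep.isStarProjection_p A).isSelfAdjoint))⟩
  partialIsometry_s a := Subtype.ext (lp.ext (funext fun π => π.rep.partialIsometry_s a))
  p_empty := Subtype.ext (lp.ext (funext fun π => π.rep.p_empty))
  p_mul_p A A' := Subtype.ext (lp.ext (funext fun π => π.rep.p_mul_p A A'))
  p_union A A' := Subtype.ext (lp.ext (funext fun π => π.rep.p_union A A'))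
  p_mul_s A a := Subtype.ext (lp.ext (funext fun π => π.rep.p_mul_s A a))
  star_s_mul_s a := Subtype.ext (lp.ext (funext fun π => π.rep.star_s_mul_s a))
  star_s_mul_s_of_ne a b h :=
    Subtype.ext (lp.ext (funext fun π => π.rep.star_s_mul_s_of_ne a b h))
  p_eq_sum A := Subtype.ext (lp.ext (funext fun π => by
    rw [coe_finsetSum_apply]
    exact π.rep.p_eq_sum A))

/-- Continuous maps out of the labeled graph C⋆-algebra are determined by the generators. -/
theorem cstar_hom_ext {B : Type*} [NonUnitalCStarAlgebra B] {φ ψ : CStar.{w} G →⋆ₙₐ[ℂ] B}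
    (hs : ∀ a, φ (G.uS a) = ψ (G.uS a)) (hp : ∀ A, φ (G.uP A) = ψ (G.uP A)) : φ = ψ := by
  have key : ∀ (x : BoundedFamilies.{w} G) (hx : x ∈ genAlgebra.{w} G),
      φ ⟨x, (genAlgebra G).le_topologicalClosure hx⟩ =
        ψ ⟨x, (genAlgebra G).le_topologicalClosure hx⟩ := by
    intro x hx
    induction hx using NonUnitalStarAlgebra.adjoin_induction with
    | mem x hx =>
      rcases hx with ⟨a, rfl⟩ | ⟨A, rfl⟩
      · exact hs a
      · exact hp A
    | add x y hx hy h1 h2 =>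
      have := congrArg₂ (· + ·) h1 h2
      simp only [← map_add] at this
      exact this
    | zero => exact (map_zero φ).trans (map_zero ψ).symm
    | mul x y hx hy h1 h2 =>
      have := congrArg₂ (· * ·) h1 h2
      simp only [← map_mul] at this
      exact this
    | smul r x hx h1 =>
      have := congrArg (r • ·) h1
      simp only [← map_smul] at this
      exact this
    | star x hx h1 =>
      have := congrArg star h1
      simp only [← map_star] at this
      exact this
  have hφ : Continuous φ :=
    AddMonoidHomClass.continuous_of_bound φ 1 fun x => by
      simpa using NonUnitalStarAlgHom.norm_apply_le φ x
  have hψ : Continuous ψ :=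
    AddMonoidHomClass.continuous_of_bound ψ 1 fun x => by
      simpa using NonUnitalStarAlgHom.norm_apply_le ψ x
  refine DFunLike.ext _ _ fun x => ?_
  have hd : Dense {x : CStar.{w} G | (x : BoundedFamilies.{w} G) ∈ genAlgebra.{w} G} := by
    intro y
    rw [closure_subtype]
    have : (Subtype.val '' {x : CStar.{w} G | (x : BoundedFamilies.{w} G) ∈ genAlgebra.{w} G}) =
        (genAlgebra.{w} G : Set (BoundedFamilies.{w} G)) := by
      ext z
      constructor
      · rintro ⟨z, hz, rfl⟩; exact hz
      · intro hz; exact ⟨⟨z, (genAlgebra G).le_topologicalClosure hz⟩, hz, rfl⟩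
    rw [this]
    exact y.2
  exact congrFun (Continuous.ext_on hd hφ hψ fun y hy => key y.1 hy) x

/-- The universal property: every representation of the labeled space in a C⋆-algebra is the
image of the universal one under a unique ⋆-homomorphism. -/
theorem existsUnique_lift {B : Type w} [NonUnitalCStarAlgebra B] (π : G.Representation B) :
    ∃! φ : CStar.{w} G →⋆ₙₐ[ℂ] B, (∀ a, φ (G.uS a) = π.s a) ∧ ∀ A, φ (G.uP A) = π.p A := by
  refine ⟨⟨⟨⟨⟨fun x => (x : BoundedFamilies.{w} G) ⟨B, π⟩, fun _ _ => rfl⟩, rfl, fun _ _ => rfl⟩,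
    fun _ _ => rfl⟩, fun _ => rfl⟩, ⟨fun _ => rfl, fun _ => rfl⟩, ?_⟩
  rintro ψ ⟨h1, h2⟩
  exact cstar_hom_ext G h1 h2

/-! ### The gauge action -/

/-- Precomposition of a bounded family with `π ↦ π.twist z`. -/
noncomputable def famTwist (z : Circle) : BoundedFamilies.{w} G →⋆ₙₐ[ℂ] BoundedFamilies.{w} G where
  toFun x := ⟨fun π => x ⟨π.algebra, π.rep.twist z⟩, memℓp_infty ⟨‖x‖, by
    rintro _ ⟨π, rfl⟩
    exact lp.norm_apply_le_norm ENNReal.top_ne_zero x ⟨π.algebra, π.rep.twist z⟩⟩⟩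
  map_smul' _ _ := rfl
  map_zero' := rfl
  map_add' _ _ := rfl
  map_mul' _ _ := rfl
  map_star' _ := rfl

theorem famTwist_mem (z : Circle) {x : BoundedFamilies.{w} G} (hx : x ∈ cstarSubalgebra.{w} G) :
    famTwist G z x ∈ cstarSubalgebra.{w} G := by
  have hc : Continuous (famTwist.{w} G z) :=
    AddMonoidHomClass.continuous_of_bound (famTwist.{w} G z) 1 fun x => by
      simpa using NonUnitalStarAlgHom.norm_apply_le (famTwist.{w} G z) x
  have hle : genAlgebra.{w} G ≤ (cstarSubalgebra.{w} G).comap (famTwist.{w} G z) := by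
    refine NonUnitalStarAlgebra.adjoin_le ?_
    rintro _ (⟨a, rfl⟩ | ⟨A, rfl⟩)
    · exact (cstarSubalgebra.{w} G).smul_mem (z : ℂ) (G.uS a).2
    · exact (G.uP A).2
  have hcl : IsClosed ((cstarSubalgebra.{w} G).comap (famTwist.{w} G z) :
      Set (BoundedFamilies.{w} G)) :=
    (genAlgebra.{w} G).isClosed_topologicalClosure.preimage hc
  exact (genAlgebra.{w} G).topologicalClosure_minimal hle hcl hx

theorem famTwist_famTwist (z z' : Circle) (x : BoundedFamilies.{w} G) :
    famTwist G z (famTwist G z' x) = famTwist G (z * z') x := by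
  refine lp.ext (funext fun π => ?_)
  have : (π.rep.twist z).twist z' = π.rep.twist (z * z') := by
    simp only [Representation.twist, Circle.coe_mul, smul_smul, mul_comm]
  change x ⟨π.algebra, (π.rep.twist z).twist z'⟩ = x ⟨π.algebra, π.rep.twist (z * z')⟩
  rw [this]

theorem famTwist_one (x : BoundedFamilies.{w} G) : famTwist G 1 x = x := by
  refine lp.ext (funext fun π => ?_)
  have : π.rep.twist 1 = π.rep := by
    simp only [Representation.twist, Circle.coe_one, one_smul]
  change x ⟨π.algebra, π.rep.twist 1⟩ = x ⟨π.algebra, π.rep⟩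
  rw [this]

/-- The gauge automorphism `γ_z`. -/
noncomputable def gauge (z : Circle) : CStar.{w} G ≃⋆ₐ[ℂ] CStar.{w} G where
  toFun x := ⟨famTwist G z x, famTwist_mem G z x.2⟩
  invFun x := ⟨famTwist G z⁻¹ x, famTwist_mem G z⁻¹ x.2⟩
  left_inv x := Subtype.ext (by
    change famTwist G z⁻¹ (famTwist G z x) = x
    rw [famTwist_famTwist, inv_mul_cancel, famTwist_one])
  right_inv x := Subtype.ext (by
    change famTwist G z (famTwist G z⁻¹ x) = x
    rw [famTwist_famTwist, mul_inv_cancel, famTwist_one])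
  map_mul' _ _ := rfl
  map_add' _ _ := rfl
  map_star' _ := rfl
  map_smul' _ _ := rfl

theorem gauge_uS (z : Circle) (a : 𝓐) : gauge.{w} G z (G.uS a) = (z : ℂ) • G.uS a := rfl

theorem gauge_uP (z : Circle) (A : G.Ebar) : gauge.{w} G z (G.uP A) = G.uP A := rfl

theorem gauge_mul (z z' : Circle) (x : CStar.{w} G) :
    gauge G (z * z') x = gauge G z (gauge G z' x) :=
  Subtype.ext (famTwist_famTwist G z z' x).symm

theorem gauge_one (x : CStar.{w} G) : gauge G 1 x = x := Subtype.ext (famTwist_one G x)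

/-- The fixed-point algebra of the gauge action. -/
noncomputable def gaugeFixed : NonUnitalStarSubalgebra ℂ (CStar.{w} G) where
  carrier := {x | ∀ z : Circle, gauge G z x = x}
  add_mem' hx hy z := by rw [map_add, hx z, hy z]
  zero_mem' z := map_zero _
  mul_mem' hx hy z := by rw [map_mul, hx z, hy z]
  smul_mem' c x hx z := by rw [map_smul, hx z]
  star_mem' hx z := by rw [map_star, hx z]

end LabeledGraph

/-! ### Two-sided sequences, subshifts and the labeled graph of a sequence -/

section Sequences

variable {𝓐 : Type u}

/-- The labeled graph `(E_ℤ, ℒ_ω)`: vertices `v_n` and edges `e_n` from `v_n` to `v_{n+1}` with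
label `ω_n`, for `n ∈ ℤ`. -/
def sequenceGraph (ω : ℤ → 𝓐) : LabeledGraph ℤ ℤ 𝓐 where
  src n := n
  tgt n := n + 1
  label n := ω n

/-- The cylinder set `ₜ[b]`. -/
def cylinder (t : ℤ) (b : List 𝓐) : Set (ℤ → 𝓐) :=
  {x | ∀ (i : ℕ) (hi : i < b.length), x (t + i) = b[i]}

/-- The cylinder set `[b.c]`, whose point separates the coordinates `-1` and `0`. -/
def dotCylinder (b c : List 𝓐) : Set (ℤ → 𝓐) := cylinder (-(b.length : ℤ)) (b ++ c)

variable [TopologicalSpace 𝓐]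

/-- The shift homeomorphism `(T x)_k = x_{k+1}`. -/
def shift : (ℤ → 𝓐) ≃ₜ (ℤ → 𝓐) where
  toFun x k := x (k + 1)
  invFun x k := x (k - 1)
  left_inv x := by ext k; simp
  right_inv x := by ext k; simp
  continuous_toFun := by fun_prop
  continuous_invFun := by fun_prop

/-- The orbit closure `𝒪_ω`. -/
def orbitClosure (ω : ℤ → 𝓐) : Set (ℤ → 𝓐) :=
  closure (Set.range fun i : ℤ => (shift ^ i : (ℤ → 𝓐) ≃ₜ (ℤ → 𝓐)) ω)

/-- A Cantor space: a nonempty compact metrizable totally disconnected space without isolated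
points. -/
structure IsCantorSpace (X : Type*) [TopologicalSpace X] : Prop where
  nonempty : Nonempty X
  compact : CompactSpace X
  metrizable : TopologicalSpace.MetrizableSpace X
  totallyDisconnected : TotallyDisconnectedSpace X
  perfect : PerfectSpace X

/-- `X`, with the restriction of the shift, is a subshift that is a Cantor minimal system. -/
structure IsCantorMinimalSubshift (X : Set (ℤ → 𝓐)) : Prop where
  isClosed : IsClosed X
  image_shift : shift '' X = X
  isCantorSpace : IsCantorSpace X
  minimal : ∀ x ∈ X, orbitClosure x = X

end Sequences

/-! Every vertex of the graph has exactly one incoming and one outgoing edge. Hence u = ∑ s_a is a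
unitary for the unit p_ℤ (`shiftUnitary_mul_star`, `star_shiftUnitary_mul`), with u p_{B+1} u* = p_B
and s_a = u p_{r(a)}: the algebra is generated by u and commuting projections, as in a crossed
product by ℤ. The operations defining Ē translate only to the right. Putting q_B = u^k p_{B+k}
u^{-k} for large k (`windowProj`) yields projections for translates in both directions.

Linear combinations of the monomials u^k q_B u^{-l} are dense, and γ_z multiplies such a monomial by
z^{k-l}. Averaging over roots of unity removes the terms with k ≠ l, so the fixed-point algebra is
the closed span of the q_B (`mem_closure_windowSpan_of_fixed`).

It remains to compute norms. Cutting into orthogonal pieces bounds ‖∑ c_i q_{B_i}‖ by sup_n |∑ c_i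
1_{B_i}(n)| (`norm_windowProj_mul_sum_le`). Conversely, the representation on ℓ²(ℤ) (`regularRep`)
sends q_B to multiplication by 1_B. Diagonal coefficients thus embed the fixed-point algebra
isometrically in ℓ^∞(ℤ). Each 1_B is the restriction to the orbit of the indicator of a clopen set,
and restriction from 𝒪_ω to its dense orbit is isometric, so the embedding takes values in C(𝒪_ω);
Stone–Weierstrass makes it onto (`exists_starAlgEquiv`). Finally, s_α p_{r(α'α)} s_α* is the q_B
with B = {n | Tⁿω ∈ [α'.α]} (`uSWord_mul_windowProj_mul_star`). -/

/-! ### Orthogonal elements of C⋆-algebras -/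

/-- The norm of a sum of two orthogonal elements of a C⋆-algebra. -/
theorem norm_add_le_max_of_orthogonal {A : Type*} [NonUnitalCStarAlgebra A] {a b : A}
    (h : star a * b = 0) (h' : a * star b = 0) : ‖a + b‖ ≤ max ‖a‖ ‖b‖ := by
  have h1 : star b * a = 0 := by simpa using congrArg star h
  have h2 : star (a + b) * (a + b) = star a * a + star b * b := by
    rw [star_add, add_mul, mul_add, mul_add, h, h1, add_zero, zero_add]
  have h3 : star a * a * (star b * b) = 0 := by
    rw [mul_assoc, ← mul_assoc a, h', zero_mul, mul_zero]
  have h4 : star b * b * (star a * a) = 0 := by simpa [mul_assoc] using congrArg star h3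
  -- Orthogonal normal elements satisfy the maximum formula; applied to a*a and b*b, the C⋆-identity
  -- makes it a formula for squared norms.
  have h5 := (IsSelfAdjoint.star_mul_self a).isStarNormal.norm_add_eq_max
    (IsSelfAdjoint.star_mul_self b).isStarNormal (h3.trans h4.symm) h3
  rw [← h2, CStarRing.norm_star_mul_self, CStarRing.norm_star_mul_self,
    CStarRing.norm_star_mul_self] at h5
  rcases le_total ‖a‖ ‖b‖ with hab | hab
  · rw [max_eq_right (mul_self_le_mul_self (norm_nonneg a) hab)] at h5
    exact le_max_of_le_right (mul_self_le_mul_self_iff (norm_nonneg _) (norm_nonneg _) |>.2 h5.le)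
  · rw [max_eq_left (mul_self_le_mul_self (norm_nonneg b) hab)] at h5
    exact le_max_of_le_left (mul_self_le_mul_self_iff (norm_nonneg _) (norm_nonneg _) |>.2 h5.le)

/-! ### Vertex sets of the labeled graph of a sequence -/

/-- The translate `A + k` of a set of integers. -/
def intTranslate (k : ℤ) (A : Set ℤ) : Set ℤ := {m | m - k ∈ A}

@[simp] theorem mem_intTranslate {k m : ℤ} {A : Set ℤ} : m ∈ intTranslate k A ↔ m - k ∈ A :=
  Iff.rfl

@[simp] theorem intTranslate_zero (A : Set ℤ) : intTranslate 0 A = A := by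
  ext m; simp

theorem intTranslate_intTranslate (k l : ℤ) (A : Set ℤ) :
    intTranslate k (intTranslate l A) = intTranslate (l + k) A := by
  ext m
  simp only [mem_intTranslate]
  rw [show m - k - l = m - (l + k) by ring]

namespace SequenceGraph

open LabeledGraph

section VertexSets

variable {𝓐 : Type u} {ω : ℤ → 𝓐}

theorem mem_cylinder_singleton {t : ℤ} {a : 𝓐} {x : ℤ → 𝓐} : x ∈ cylinder t [a] ↔ x t = a := by
  simp [cylinder]

theorem mem_cylinder_cons {t : ℤ} {a : 𝓐} {α : List 𝓐} {x : ℤ → 𝓐} :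
    x ∈ cylinder t (a :: α) ↔ x t = a ∧ x ∈ cylinder (t + 1) α := by
  constructor
  · intro h
    have h0 := h 0 (by simp)
    rw [Nat.cast_zero, add_zero] at h0
    refine ⟨h0, fun i hi => ?_⟩
    have := h (i + 1) (by simpa using hi)
    rw [List.getElem_cons_succ] at this
    rw [← this]
    push_cast
    congr 1
    ring
  · rintro ⟨h0, h⟩ i hi
    cases i with
    | zero => simpa using h0
    | succ i =>
      rw [List.getElem_cons_succ, ← h i (by simpa using hi)]
      push_cast
      congr 1
      ring

theorem mem_cylinder_append {t : ℤ} {α β : List 𝓐} {x : ℤ → 𝓐} :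
    x ∈ cylinder t (α ++ β) ↔ x ∈ cylinder t α ∧ x ∈ cylinder (t + α.length) β := by
  induction α generalizing t with
  | nil => simp [cylinder]
  | cons a α ih =>
    rw [List.cons_append, mem_cylinder_cons, mem_cylinder_cons, ih, and_assoc]
    simp only [List.length_cons]
    push_cast
    rw [show t + 1 + (α.length : ℤ) = t + (α.length + 1) by ring]

/-- One edge leaves each vertex, so a path is determined by its source and length, and its label is
read off ω. -/
theorem pathFrom_iff {v x : ℤ} {α : List 𝓐} :
    (sequenceGraph ω).PathFrom v α x ↔ x = v + α.length ∧ ω ∈ cylinder v α := by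
  constructor
  · intro h
    induction h with
    | nil v => exact ⟨by simp, fun i hi => by simp at hi⟩
    | cons e _ ih =>
      obtain ⟨rfl, h⟩ := ih
      refine ⟨?_, mem_cylinder_cons.2 ⟨rfl, h⟩⟩
      simp only [sequenceGraph, List.length_cons]
      push_cast
      ring
  · rintro ⟨rfl, h⟩
    induction α generalizing v with
    | nil => simpa using PathFrom.nil v
    | cons a α ih =>
      obtain ⟨rfl, h1⟩ := mem_cylinder_cons.1 h
      have := PathFrom.cons (G := sequenceGraph ω) v (ih h1)
      rw [List.length_cons, Nat.cast_succ, add_comm (α.length : ℤ), ← add_assoc]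
      exact this

theorem mem_relRange {A : Set ℤ} {α : List 𝓐} {m : ℤ} :
    m ∈ (sequenceGraph ω).relRange A α ↔ m - α.length ∈ A ∧ ω ∈ cylinder (m - α.length) α := by
  constructor
  · rintro ⟨v, hv, h⟩
    obtain ⟨rfl, h'⟩ := pathFrom_iff.1 h
    rw [add_sub_cancel_right]
    exact ⟨hv, h'⟩
  · rintro ⟨h1, h2⟩
    exact ⟨_, h1, pathFrom_iff.2 ⟨by ring, h2⟩⟩

theorem mem_range {α : List 𝓐} {m : ℤ} :
    m ∈ (sequenceGraph ω).range α ↔ ω ∈ cylinder (m - α.length) α := by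
  simp [LabeledGraph.range, mem_relRange]

theorem mem_relRange_singleton {A : Set ℤ} {a : 𝓐} {m : ℤ} :
    m ∈ (sequenceGraph ω).relRange A [a] ↔ m - 1 ∈ A ∧ ω (m - 1) = a := by
  simp [mem_relRange, mem_cylinder_singleton]

theorem mem_range_singleton {a : 𝓐} {m : ℤ} :
    m ∈ (sequenceGraph ω).range [a] ↔ ω (m - 1) = a := by
  simp [mem_range, mem_cylinder_singleton]

theorem mem_labelsFrom {A : Set ℤ} {a : 𝓐} :
    a ∈ (sequenceGraph ω).labelsFrom A ↔ ∃ n ∈ A, ω n = a := Iff.rfl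

/-- One edge enters each vertex, so following the letter a is translation by one, cut down to r(a).
-/
theorem relRange_singleton_eq (A : Set ℤ) (a : 𝓐) :
    (sequenceGraph ω).relRange A [a] = (sequenceGraph ω).range [a] ∩ intTranslate 1 A := by
  ext m
  simp [mem_relRange_singleton, mem_range_singleton, and_comm]

theorem range_inter_range {a b : 𝓐} (h : a ≠ b) :
    (sequenceGraph ω).range [a] ∩ (sequenceGraph ω).range [b] = ∅ := by
  ext m
  simp only [Set.mem_inter_iff, mem_range_singleton, Set.mem_empty_iff_false, iff_false]
  rintro ⟨rfl, h'⟩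
  exact h h'

theorem range_singleton_mem_Ebar (a : 𝓐) :
    (sequenceGraph ω).range [a] ∈ (sequenceGraph ω).Ebar :=
  range_mem_Ebar _ (List.cons_ne_nil a [])

theorem biUnion_mem_Ebar {ι : Type*} (t : Finset ι) (F : ι → Set ℤ)
    (hF : ∀ i, F i ∈ (sequenceGraph ω).Ebar) : (⋃ i ∈ t, F i) ∈ (sequenceGraph ω).Ebar := by
  classical
  induction t using Finset.induction_on with
  | empty => simpa using (sequenceGraph ω).isNormalAccommodating_Ebar.empty_mem
  | insert i t hi ih =>
    rw [Finset.set_biUnion_insert]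
    exact (sequenceGraph ω).isNormalAccommodating_Ebar.union_mem _ (hF i) _ ih

theorem biUnion_range [Fintype 𝓐] :
    (⋃ a ∈ (Finset.univ : Finset 𝓐), (sequenceGraph ω).range [a]) = Set.univ := by
  ext m
  simp [mem_range_singleton]

theorem univ_mem_Ebar [Finite 𝓐] : Set.univ ∈ (sequenceGraph ω).Ebar := by
  have := Fintype.ofFinite 𝓐
  rw [← biUnion_range (ω := ω)]
  exact biUnion_mem_Ebar _ _ fun a => range_mem_Ebar _ (List.cons_ne_nil a [])

/-- The translate is the union of the relative ranges over all letters, a finite union. -/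
theorem intTranslate_one_mem_Ebar [Finite 𝓐] {A : Set ℤ} (hA : A ∈ (sequenceGraph ω).Ebar) :
    intTranslate 1 A ∈ (sequenceGraph ω).Ebar := by
  have := Fintype.ofFinite 𝓐
  have h : intTranslate 1 A =
      ⋃ a ∈ (Finset.univ : Finset 𝓐), (sequenceGraph ω).relRange A [a] := by
    ext m
    simp [mem_relRange_singleton]
  rw [h]
  exact biUnion_mem_Ebar _ _ fun a => relRange_mem_Ebar _ hA (List.cons_ne_nil a [])

theorem intTranslate_natCast_mem_Ebar [Finite 𝓐] {A : Set ℤ} (hA : A ∈ (sequenceGraph ω).Ebar)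
    (k : ℕ) : intTranslate k A ∈ (sequenceGraph ω).Ebar := by
  induction k with
  | zero => simpa using hA
  | succ k ih =>
    have := intTranslate_one_mem_Ebar ih
    rwa [intTranslate_intTranslate] at this

variable (ω) in
/-- The sets of integers some translate of which to the right belongs to `Ē`. They form the
Boolean algebra of all sets `{n | Tⁿ ω ∈ K}`, with `K` clopen. -/
def windowSets : Set (Set ℤ) := {B | ∃ k : ℕ, intTranslate k B ∈ (sequenceGraph ω).Ebar}

theorem mem_windowSets_of_mem_Ebar {A : Set ℤ} (hA : A ∈ (sequenceGraph ω).Ebar) :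
    A ∈ windowSets ω := ⟨0, by simpa using hA⟩

variable [Finite 𝓐]

theorem intTranslate_mem_Ebar_of_le {B : Set ℤ} {k l : ℕ} (h : k ≤ l)
    (hk : intTranslate k B ∈ (sequenceGraph ω).Ebar) :
    intTranslate l B ∈ (sequenceGraph ω).Ebar := by
  obtain ⟨m, rfl⟩ := Nat.exists_eq_add_of_le h
  have := intTranslate_natCast_mem_Ebar hk m
  rw [intTranslate_intTranslate] at this
  exact_mod_cast this

theorem exists_common_translate {B C : Set ℤ} (hB : B ∈ windowSets ω) (hC : C ∈ windowSets ω) :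
    ∃ k : ℕ, intTranslate k B ∈ (sequenceGraph ω).Ebar ∧
      intTranslate k C ∈ (sequenceGraph ω).Ebar := by
  obtain ⟨k, hk⟩ := hB
  obtain ⟨l, hl⟩ := hC
  exact ⟨max k l, intTranslate_mem_Ebar_of_le (le_max_left _ _) hk,
    intTranslate_mem_Ebar_of_le (le_max_right _ _) hl⟩

theorem inter_mem_windowSets {B C : Set ℤ} (hB : B ∈ windowSets ω) (hC : C ∈ windowSets ω) :
    B ∩ C ∈ windowSets ω := by
  obtain ⟨k, hk, hl⟩ := exists_common_translate hB hC
  exact ⟨k, (sequenceGraph ω).isNormalAccommodating_Ebar.inter_mem _ hk _ hl⟩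

theorem diff_mem_windowSets {B C : Set ℤ} (hB : B ∈ windowSets ω) (hC : C ∈ windowSets ω) :
    B \ C ∈ windowSets ω := by
  obtain ⟨k, hk, hl⟩ := exists_common_translate hB hC
  exact ⟨k, (sequenceGraph ω).isNormalAccommodating_Ebar.diff_mem _ hk _ hl⟩

theorem univ_mem_windowSets : Set.univ ∈ windowSets ω := mem_windowSets_of_mem_Ebar univ_mem_Ebar

theorem intTranslate_mem_windowSets {B : Set ℤ} (hB : B ∈ windowSets ω) (t : ℤ) :
    intTranslate t B ∈ windowSets ω := by
  obtain ⟨k, hk⟩ := hB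
  -- This amount is nonnegative, and together with t it makes a translation by k + |t|, which stays
  -- in Ē.
  refine ⟨k + t.natAbs - t |>.toNat, ?_⟩
  have h : ((k + t.natAbs - t).toNat : ℤ) = k + t.natAbs - t := by omega
  have := intTranslate_natCast_mem_Ebar hk t.natAbs
  rw [intTranslate_intTranslate] at this ⊢
  rw [h]
  convert this using 2
  ring

/-- A translate of r(a), with offset t + 1 because r(a) reads the letter ω_{m-1} of the incoming
edge. These sets will separate the points of 𝒪_ω. -/
theorem setOf_coord_mem_windowSets (t : ℤ) (a : 𝓐) : {n | ω (n + t) = a} ∈ windowSets ω := by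
  have := intTranslate_mem_windowSets (mem_windowSets_of_mem_Ebar
    ((sequenceGraph ω).range_mem_Ebar (List.cons_ne_nil a []))) (-(t + 1))
  convert this using 1
  ext n
  simp only [Set.mem_ofPred_eq, mem_intTranslate, mem_range_singleton]
  rw [show n - -(t + 1) - 1 = n + t by ring]

end VertexSets

/-! ### The unitary implementing the translation -/

section Rep

variable {𝓐 : Type u} [Fintype 𝓐] {ω : ℤ → 𝓐} {A : Type w} [NonUnitalCStarAlgebra A]
  (π : (sequenceGraph ω).Representation A)

open Classical in
/-- The projections of a representation, extended by zero to all sets of vertices. -/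
noncomputable def proj (B : Set ℤ) : A :=
  if h : B ∈ (sequenceGraph ω).Ebar then π.p ⟨B, h⟩ else 0

theorem proj_of_mem {B : Set ℤ} (h : B ∈ (sequenceGraph ω).Ebar) : proj π B = π.p ⟨B, h⟩ :=
  dif_pos h

theorem star_proj (B : Set ℤ) : star (proj π B) = proj π B := by
  unfold proj
  split_ifs with h
  · exact (π.isStarProjection_p ⟨B, h⟩).isSelfAdjoint
  · exact star_zero A

theorem proj_mul_proj {B C : Set ℤ} (hB : B ∈ (sequenceGraph ω).Ebar)
    (hC : C ∈ (sequenceGraph ω).Ebar) : proj π B * proj π C = proj π (B ∩ C) := by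
  rw [proj_of_mem π hB, proj_of_mem π hC, π.p_mul_p, proj_of_mem]

theorem proj_empty : proj π ∅ = 0 := by
  rw [proj_of_mem π (sequenceGraph ω).isNormalAccommodating_Ebar.empty_mem, π.p_empty]

theorem proj_union {B C : Set ℤ} (hB : B ∈ (sequenceGraph ω).Ebar)
    (hC : C ∈ (sequenceGraph ω).Ebar) (h : B ∩ C = ∅) :
    proj π (B ∪ C) = proj π B + proj π C := by
  have hBC := (sequenceGraph ω).isNormalAccommodating_Ebar.union_mem _ hB _ hC
  have hi := (sequenceGraph ω).isNormalAccommodating_Ebar.inter_mem _ hB _ hC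
  have := π.p_union ⟨B, hB⟩ ⟨C, hC⟩
  rw [← proj_of_mem π hB, ← proj_of_mem π hC, ← proj_of_mem π hBC, ← proj_of_mem π hi, h,
    proj_empty, sub_zero] at this
  exact this

theorem proj_biUnion {ι : Type*} (t : Finset ι) (F : ι → Set ℤ)
    (hF : ∀ i, F i ∈ (sequenceGraph ω).Ebar) (hd : ∀ i j, i ≠ j → F i ∩ F j = ∅) :
    proj π (⋃ i ∈ t, F i) = ∑ i ∈ t, proj π (F i) := by
  classical
  induction t using Finset.induction_on with
  | empty => simpa using proj_empty π
  | insert i t hi ih =>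
    rw [Finset.set_biUnion_insert, Finset.sum_insert hi,
      proj_union π (hF i) (biUnion_mem_Ebar t F hF), ih]
    rw [Set.inter_iUnion₂]
    simp only [Set.iUnion_eq_empty]
    intro j hj
    exact hd i j fun h => hi (h ▸ hj)

theorem star_s_mul_s (a : 𝓐) :
    star (π.s a) * π.s a = proj π ((sequenceGraph ω).range [a]) := by
  rw [π.star_s_mul_s, proj_of_mem]

theorem s_mul_proj_range (a : 𝓐) :
    π.s a * proj π ((sequenceGraph ω).range [a]) = π.s a := by
  rw [← star_s_mul_s, ← mul_assoc, π.partialIsometry_s]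

theorem s_mul_proj {B : Set ℤ} (hB : B ∈ (sequenceGraph ω).Ebar) (a : 𝓐) :
    π.s a * proj π B = π.s a * proj π ((sequenceGraph ω).range [a] ∩ B) := by
  conv_lhs => rw [← s_mul_proj_range]
  rw [mul_assoc, proj_mul_proj π (range_singleton_mem_Ebar a) hB]

/-- The cut-down to r(a) in r(B, a) is absorbed by s_a. What remains on the right does not depend on
the letter, so the relation can be summed over a. -/
theorem proj_mul_s {B : Set ℤ} (hB : B ∈ (sequenceGraph ω).Ebar) (a : 𝓐) :
    proj π B * π.s a = π.s a * proj π (intTranslate 1 B) := by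
  rw [s_mul_proj π (intTranslate_one_mem_Ebar hB), ← relRange_singleton_eq, proj_of_mem π hB,
    π.p_mul_s, proj_of_mem]

theorem s_mul_proj_range_of_ne {a b : 𝓐} (h : a ≠ b) :
    π.s a * proj π ((sequenceGraph ω).range [b]) = 0 := by
  rw [s_mul_proj π (range_singleton_mem_Ebar b), range_inter_range h, proj_empty, mul_zero]

/-- Not a defining relation: it holds because r(a) and r(b) are disjoint, so that the initial
projections are orthogonal. -/
theorem s_mul_star_s_of_ne {a b : 𝓐} (h : a ≠ b) : π.s a * star (π.s b) = 0 := by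
  rw [← s_mul_proj_range π b, star_mul, star_proj, ← mul_assoc, s_mul_proj_range_of_ne π h,
    zero_mul]

theorem sum_s_mul_star_s : ∑ a, π.s a * star (π.s a) = proj π Set.univ := by
  rw [proj_of_mem π univ_mem_Ebar, π.p_eq_sum]
  symm
  have h (a : 𝓐) : π.s a * π.p ⟨(sequenceGraph ω).relRange Set.univ [a],
      relRange_mem_Ebar _ univ_mem_Ebar (List.cons_ne_nil a [])⟩ * star (π.s a) =
      π.s a * star (π.s a) := by
    have := s_mul_proj_range π a
    rw [proj_of_mem π (range_singleton_mem_Ebar a)] at this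
    exact congrArg (· * star (π.s a)) this
  simp only [h]
  -- A letter that does not occur in ω has empty range, hence s_a = 0, and it may be added to the
  -- sum.
  refine Finset.sum_subset (Finset.subset_univ _) fun a _ ha => ?_
  have h0 : (sequenceGraph ω).range [a] = ∅ := by
    ext m
    simp only [mem_range_singleton, Set.mem_empty_iff_false, iff_false]
    intro hm
    exact ha ((Set.Finite.mem_toFinset _).2 (mem_labelsFrom.2 ⟨m - 1, trivial, hm⟩))
  rw [← s_mul_proj_range π a, h0, proj_empty, mul_zero, zero_mul]

/-- The sum of the partial isometries of a representation. -/
noncomputable def shiftUnitary : A := ∑ a, π.s a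

theorem shiftUnitary_mul_star : shiftUnitary π * star (shiftUnitary π) = proj π Set.univ := by
  classical
  rw [shiftUnitary, star_sum, Finset.sum_mul_sum, ← sum_s_mul_star_s π]
  refine Finset.sum_congr rfl fun a _ => ?_
  exact Finset.sum_eq_single a (fun b _ h => s_mul_star_s_of_ne π h.symm) (by simp)

/-- The cross terms vanish and the diagonal ones are the p_{r(a)}, whose sets partition ℤ. -/
theorem star_shiftUnitary_mul : star (shiftUnitary π) * shiftUnitary π = proj π Set.univ := by
  classical
  rw [shiftUnitary, star_sum, Finset.sum_mul_sum, ← biUnion_range (ω := ω),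
    proj_biUnion π _ _ range_singleton_mem_Ebar fun a b => range_inter_range]
  refine Finset.sum_congr rfl fun a _ => ?_
  rw [← star_s_mul_s]
  exact Finset.sum_eq_single a (fun b _ h => π.star_s_mul_s_of_ne a b h.symm) (by simp)

theorem proj_mul_shiftUnitary {B : Set ℤ} (hB : B ∈ (sequenceGraph ω).Ebar) :
    proj π B * shiftUnitary π = shiftUnitary π * proj π (intTranslate 1 B) := by
  simp only [shiftUnitary, Finset.mul_sum, Finset.sum_mul, proj_mul_s π hB]

/-- Recovers the generators s_a from u and the projections. -/
theorem shiftUnitary_mul_proj_range (a : 𝓐) :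
    shiftUnitary π * proj π ((sequenceGraph ω).range [a]) = π.s a := by
  classical
  rw [shiftUnitary, Finset.sum_mul,
    Finset.sum_eq_single a (fun b _ h => s_mul_proj_range_of_ne π h) (by simp), s_mul_proj_range]

/-! ### Conjugation by u, and projections for translates in both directions -/

variable (he : ∀ x, proj π Set.univ * x = x)
include he

theorem mul_proj_univ (x : A) : x * proj π Set.univ = x := by
  have := congrArg star (he (star x))
  rwa [star_mul, star_star, star_proj] at this

/-- Conjugation by the unitary `shiftUnitary π`. -/
noncomputable def conjShift : A →⋆ₙₐ[ℂ] A where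
  toFun x := shiftUnitary π * x * star (shiftUnitary π)
  map_smul' c x := by simp [mul_smul_comm, smul_mul_assoc]
  map_zero' := by simp
  map_add' x y := by simp [mul_add, add_mul]
  map_mul' x y := by
    have : shiftUnitary π * x * star (shiftUnitary π) *
        (shiftUnitary π * y * star (shiftUnitary π)) =
        shiftUnitary π * (x * (star (shiftUnitary π) * shiftUnitary π)) * y *
          star (shiftUnitary π) := by
      simp only [mul_assoc]
    rw [this, star_shiftUnitary_mul, mul_proj_univ π he, mul_assoc (shiftUnitary π) x y]
  map_star' x := by simp only [star_mul, star_star, mul_assoc]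

theorem conjShift_apply (x : A) :
    conjShift π he x = shiftUnitary π * x * star (shiftUnitary π) := rfl

theorem conjShift_proj {B : Set ℤ} (hB : B ∈ (sequenceGraph ω).Ebar) :
    conjShift π he (proj π (intTranslate 1 B)) = proj π B := by
  rw [conjShift_apply, ← proj_mul_shiftUnitary π hB, mul_assoc, shiftUnitary_mul_star,
    mul_proj_univ π he]

theorem iterate_conjShift_proj {B : Set ℤ} (hB : B ∈ (sequenceGraph ω).Ebar) (k : ℕ) :
    (conjShift π he)^[k] (proj π (intTranslate k B)) = proj π B := by
  induction k with
  | zero => simp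
  | succ k ih =>
    rw [Nat.cast_succ, ← intTranslate_intTranslate, Function.iterate_succ_apply,
      conjShift_proj π he (intTranslate_natCast_mem_Ebar hB k), ih]

open Classical in
/-- The projections `u^k p_{B + k} u^{-k}`, where `u = shiftUnitary π`, which extend the family
`proj π` to all the sets in `windowSets ω`. -/
noncomputable def windowProj (B : Set ℤ) : A :=
  if h : B ∈ windowSets ω then (conjShift π he)^[h.choose] (proj π (intTranslate h.choose B)) else 0

/-- Independence of the translation: m further steps to the right are undone by m further
conjugations, so two admissible values l and k both agree with l + k. -/
theorem windowProj_eq {B : Set ℤ} {k : ℕ} (hk : intTranslate k B ∈ (sequenceGraph ω).Ebar) :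
    windowProj π he B = (conjShift π he)^[k] (proj π (intTranslate k B)) := by
  have aux (l m : ℕ) (hl : intTranslate l B ∈ (sequenceGraph ω).Ebar) :
      (conjShift π he)^[l + m] (proj π (intTranslate (l + m : ℕ) B)) =
        (conjShift π he)^[l] (proj π (intTranslate l B)) := by
    rw [Function.iterate_add_apply, Nat.cast_add, ← intTranslate_intTranslate,
      iterate_conjShift_proj π he hl]
  have h : B ∈ windowSets ω := ⟨k, hk⟩
  rw [windowProj, dif_pos h]
  rw [← aux _ k h.choose_spec, ← aux _ h.choose hk, add_comm]

theorem windowProj_of_mem_Ebar {B : Set ℤ} (hB : B ∈ (sequenceGraph ω).Ebar) :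
    windowProj π he B = proj π B := by
  rw [windowProj_eq π he (k := 0) (by simpa using hB)]
  simp

theorem conjShift_windowProj {B : Set ℤ} (hB : B ∈ windowSets ω) :
    conjShift π he (windowProj π he (intTranslate 1 B)) = windowProj π he B := by
  obtain ⟨k, hk⟩ := hB
  have hk' := intTranslate_one_mem_Ebar hk
  rw [intTranslate_intTranslate] at hk'
  have h1 : intTranslate k (intTranslate 1 B) ∈ (sequenceGraph ω).Ebar := by
    rwa [intTranslate_intTranslate, add_comm]
  rw [windowProj_eq π he h1, windowProj_eq π he (k := k + 1) (by exact_mod_cast hk'),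
    Function.iterate_succ_apply', intTranslate_intTranslate, Nat.cast_succ, add_comm (1 : ℤ)]

theorem iterate_conjShift_windowProj {B : Set ℤ} (hB : B ∈ windowSets ω) (k : ℕ) :
    (conjShift π he)^[k] (windowProj π he B) = windowProj π he (intTranslate (-k) B) := by
  induction k with
  | zero => simp
  | succ k ih =>
    rw [Function.iterate_succ_apply', ih, ← conjShift_windowProj π he
      (intTranslate_mem_windowSets hB (-(k + 1 : ℕ))), intTranslate_intTranslate]
    congr 3
    push_cast
    ring

theorem windowProj_mul {B C : Set ℤ} (hB : B ∈ windowSets ω) (hC : C ∈ windowSets ω) :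
    windowProj π he B * windowProj π he C = windowProj π he (B ∩ C) := by
  obtain ⟨k, hk, hl⟩ := exists_common_translate hB hC
  have := (sequenceGraph ω).isNormalAccommodating_Ebar.inter_mem _ hk _ hl
  rw [windowProj_eq π he hk, windowProj_eq π he hl, windowProj_eq π he (B := B ∩ C) this,
    ← iterate_map_mul, proj_mul_proj π hk hl]
  rfl

theorem windowProj_union {B C : Set ℤ} (hB : B ∈ windowSets ω) (hC : C ∈ windowSets ω)
    (h : B ∩ C = ∅) :
    windowProj π he (B ∪ C) = windowProj π he B + windowProj π he C := by
  obtain ⟨k, hk, hl⟩ := exists_common_translate hB hC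
  have := (sequenceGraph ω).isNormalAccommodating_Ebar.union_mem _ hk _ hl
  have h' : intTranslate k B ∩ intTranslate k C = ∅ := by
    change intTranslate k (B ∩ C) = ∅
    rw [h]
    rfl
  rw [windowProj_eq π he hk, windowProj_eq π he hl, windowProj_eq π he (B := B ∪ C) this,
    ← iterate_map_add, ← proj_union π hk hl h']
  rfl

theorem windowProj_empty : windowProj π he ∅ = 0 := by
  rw [windowProj_of_mem_Ebar π he (sequenceGraph ω).isNormalAccommodating_Ebar.empty_mem,
    proj_empty]

theorem star_windowProj (B : Set ℤ) : star (windowProj π he B) = windowProj π he B := by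
  have aux (k : ℕ) (x : A) (hx : star x = x) :
      star ((conjShift π he)^[k] x) = (conjShift π he)^[k] x := by
    induction k with
    | zero => simpa using hx
    | succ k ih => rw [Function.iterate_succ_apply', ← map_star, ih]
  unfold windowProj
  split_ifs with h
  · exact aux _ _ (star_proj π _)
  · exact star_zero A

theorem s_mul_windowProj_mul_star_s {B : Set ℤ} (hB : B ∈ windowSets ω) (a : 𝓐) :
    π.s a * windowProj π he B * star (π.s a) =
      windowProj π he {n | ω n = a ∧ n + 1 ∈ B} := by
  have ha := mem_windowSets_of_mem_Ebar (range_singleton_mem_Ebar (ω := ω) a)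
  -- Since s_a = u p_{r(a)}, the factors s_a and s_a* each contribute one r(a) around B; conjugation
  -- by u then translates by -1.
  have hC : {n | ω n = a ∧ n + 1 ∈ B} =
      intTranslate (-1) ((sequenceGraph ω).range [a] ∩ B ∩ (sequenceGraph ω).range [a]) := by
    ext n
    simp [mem_range_singleton]
    tauto
  rw [hC, ← Nat.cast_one, ← iterate_conjShift_windowProj π he
    (inter_mem_windowSets (inter_mem_windowSets ha hB) ha), Function.iterate_one, conjShift_apply,
    ← windowProj_mul π he (inter_mem_windowSets ha hB) ha, ← windowProj_mul π he ha hB,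
    windowProj_of_mem_Ebar π he (range_singleton_mem_Ebar a), ← shiftUnitary_mul_proj_range π a,
    star_mul, star_proj]
  simp only [mul_assoc]

end Rep

open Filter

section Averaging

variable {𝓐 : Type u} [Fintype 𝓐] {ω : ℤ → 𝓐} {A : Type w} [NonUnitalCStarAlgebra A]
  (π : (sequenceGraph ω).Representation A) (he : ∀ x, proj π Set.univ * x = x)

/-! ### The span of the projections -/

theorem norm_windowProj_le (B : Set ℤ) (hB : B ∈ windowSets ω) : ‖windowProj π he B‖ ≤ 1 :=
  IsStarProjection.norm_le _
    ⟨by rw [IsIdempotentElem, windowProj_mul π he hB hB, Set.inter_self], star_windowProj π he B⟩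

-- Induction on the number of terms, with μ and C free. Cutting C by B_i, the i-th term becomes the
-- constant c_i on C ∩ B_i, to be added to μ, and vanishes on C \ B_i. The two pieces are
-- orthogonal, so the norm of their sum is at most the larger of their norms.
open Classical in
theorem norm_windowProj_mul_sum_le {ι : Type*} (t : Finset ι) (c : ι → ℂ) (B : ι → Set ℤ)
    (hB : ∀ i, B i ∈ windowSets ω) {M : ℝ} (hM : 0 ≤ M) (μ : ℂ) (C : Set ℤ)
    (hC : C ∈ windowSets ω)
    (h : ∀ n ∈ C, ‖μ + ∑ i ∈ t, c i * (B i).indicator 1 n‖ ≤ M) :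
    ‖windowProj π he C * (μ • proj π Set.univ + ∑ i ∈ t, c i • windowProj π he (B i))‖ ≤ M := by
  induction t using Finset.induction_on generalizing μ C with
  | empty =>
    rw [Finset.sum_empty, add_zero, mul_smul_comm, mul_proj_univ π he]
    rcases C.eq_empty_or_nonempty with rfl | ⟨n, hn⟩
    · simpa [windowProj_empty] using hM
    · have := h n hn
      rw [Finset.sum_empty, add_zero] at this
      rw [norm_smul]
      calc _ ≤ ‖μ‖ * 1 := by gcongr; exact norm_windowProj_le π he C hC
        _ ≤ M := by simpa using this
  | insert i t hi ih =>
    set x := ∑ j ∈ t, c j • windowProj π he (B j) with hx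
    have hD := inter_mem_windowSets hC (hB i)
    have hD' := diff_mem_windowSets hC (hB i)
    have h1 := ih (μ + c i) (C ∩ B i) hD fun n hn => by
      have := h n hn.1
      rw [Finset.sum_insert hi, Set.indicator_of_mem hn.2, Pi.one_apply, mul_one, ← add_assoc]
        at this
      exact this
    have h2 := ih μ (C \ B i) hD' fun n hn => by
      have := h n hn.1
      rw [Finset.sum_insert hi, Set.indicator_of_notMem hn.2, mul_zero, zero_add] at this
      exact this
    have hdisj : (C ∩ B i) ∩ (C \ B i) = ∅ := by ext; simp; tauto
    have hsum : windowProj π he C = windowProj π he (C ∩ B i) + windowProj π he (C \ B i) := by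
      rw [← windowProj_union π he hD hD' hdisj, Set.inter_union_sdiff]
    have hcomm (D E : Set ℤ) (hDm : D ∈ windowSets ω) (hEm : E ∈ windowSets ω) :
        Commute (windowProj π he D) (windowProj π he E) := by
      rw [Commute, SemiconjBy, windowProj_mul π he hDm hEm, windowProj_mul π he hEm hDm,
        Set.inter_comm]
    have hcx (D : Set ℤ) (hDm : D ∈ windowSets ω) (ν : ℂ) :
        Commute (windowProj π he D) (ν • proj π Set.univ + x) := by
      refine Commute.add_right ?_ ?_
      · rw [← windowProj_of_mem_Ebar π he univ_mem_Ebar]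
        exact (hcomm D _ hDm univ_mem_windowSets).smul_right ν
      · exact Commute.sum_right _ _ _ fun j _ => (hcomm D _ hDm (hB j)).smul_right (c j)
    have hzero : windowProj π he (C ∩ B i) * windowProj π he (C \ B i) = 0 := by
      rw [windowProj_mul π he hD hD', hdisj, windowProj_empty]
    have key : windowProj π he C *
        (μ • proj π Set.univ + ∑ j ∈ insert i t, c j • windowProj π he (B j)) =
        windowProj π he (C ∩ B i) * ((μ + c i) • proj π Set.univ + x) +
          windowProj π he (C \ B i) * (μ • proj π Set.univ + x) := by
      have e1 : windowProj π he C * windowProj π he (B i) = windowProj π he (C ∩ B i) :=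
        windowProj_mul π he hC (hB i)
      rw [Finset.sum_insert hi, ← hx, mul_add, mul_add, mul_smul_comm, mul_smul_comm, e1, mul_add,
        mul_add, mul_smul_comm, mul_smul_comm]
      simp only [mul_proj_univ π he]
      rw [hsum]
      simp only [add_mul, add_smul, smul_add]
      abel
    rw [key]
    refine (norm_add_le_max_of_orthogonal ?_ ?_).trans (max_le h1 h2)
    · rw [star_mul, star_windowProj, mul_assoc, ← mul_assoc (windowProj π he (C ∩ B i)), hzero,
        zero_mul, mul_zero]
    · rw [(hcx _ hD (μ + c i)).eq, (hcx _ hD' μ).eq, star_mul, star_windowProj, mul_assoc,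
        ← mul_assoc (windowProj π he (C ∩ B i)), hzero, zero_mul, mul_zero]

/-- The linear span of the projections `windowProj`. -/
noncomputable def windowSpan : Submodule ℂ A :=
  Submodule.span ℂ (windowProj π he '' windowSets ω)

theorem windowProj_mem_windowSpan {B : Set ℤ} (hB : B ∈ windowSets ω) :
    windowProj π he B ∈ windowSpan π he := Submodule.subset_span ⟨B, hB, rfl⟩

theorem exists_eq_sum_of_mem_windowSpan {x : A} (hx : x ∈ windowSpan π he) :
    ∃ (n : ℕ) (c : Fin n → ℂ) (B : Fin n → Set ℤ), (∀ i, B i ∈ windowSets ω) ∧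
      x = ∑ i, c i • windowProj π he (B i) := by
  obtain ⟨n, c, g, rfl⟩ := Submodule.mem_span_set'.1 hx
  choose B hB using fun i => (g i).2
  exact ⟨n, c, B, fun i => (hB i).1, Finset.sum_congr rfl fun i _ => by rw [(hB i).2]⟩

/-- The map `ev` makes the function ∑ c_i 1_{B_i} depend only on the element x; the representation
on ℓ²(ℤ) will supply it. -/
theorem norm_le_of_mem_windowSpan {x : A} (hx : x ∈ windowSpan π he) {ev : A →ₗ[ℂ] (ℤ → ℂ)}
    (hev : ∀ B ∈ windowSets ω, ev (windowProj π he B) = B.indicator 1) {M : ℝ} (hM : 0 ≤ M)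
    (h : ∀ n, ‖ev x n‖ ≤ M) : ‖x‖ ≤ M := by
  obtain ⟨n, c, B, hB, rfl⟩ := exists_eq_sum_of_mem_windowSpan π he hx
  have := norm_windowProj_mul_sum_le π he Finset.univ c B hB hM 0 Set.univ univ_mem_windowSets
    fun m _ => by
      have := h m
      simp only [map_sum, map_smul, hev _ (hB _), Finset.sum_apply, Pi.smul_apply,
        smul_eq_mul] at this
      rwa [zero_add]
  rwa [zero_smul, zero_add, windowProj_of_mem_Ebar π he univ_mem_Ebar, he] at this

/-! ### Monomials -/

/-- The powers of `shiftUnitary π`. -/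
noncomputable def shiftPow : ℕ → A
  -- The algebra is not assumed unital; p_ℤ serves as its unit.
  | 0 => proj π Set.univ
  | k + 1 => shiftUnitary π * shiftPow k

include he in
theorem shiftPow_add (k l : ℕ) : shiftPow π (k + l) = shiftPow π k * shiftPow π l := by
  induction k with
  | zero => rw [Nat.zero_add, shiftPow, he]
  | succ k ih => rw [Nat.succ_add, shiftPow, shiftPow, ih, mul_assoc]

include he in
theorem star_shiftPow_mul (k : ℕ) : star (shiftPow π k) * shiftPow π k = proj π Set.univ := by
  induction k with
  | zero => rw [shiftPow, star_proj, he]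
  | succ k ih =>
    rw [shiftPow, star_mul, mul_assoc, ← mul_assoc (star (shiftUnitary π)),
      star_shiftUnitary_mul, he, ih]

theorem windowProj_mul_shiftPow {B : Set ℤ} (hB : B ∈ windowSets ω) (k : ℕ) :
    windowProj π he B * shiftPow π k = shiftPow π k * windowProj π he (intTranslate k B) := by
  induction k generalizing B with
  | zero => simp [shiftPow, he, mul_proj_univ π he]
  | succ k ih =>
    have h1 : windowProj π he B * shiftUnitary π =
        shiftUnitary π * windowProj π he (intTranslate 1 B) := by
      rw [← conjShift_windowProj π he hB, conjShift_apply, mul_assoc, star_shiftUnitary_mul,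
        mul_proj_univ π he]
    rw [shiftPow, ← mul_assoc, h1, mul_assoc, ih (intTranslate_mem_windowSets hB 1), mul_assoc,
      intTranslate_intTranslate, add_comm (1 : ℤ), Nat.cast_succ]

theorem shiftPow_mul_windowProj_mul_star {B : Set ℤ} (hB : B ∈ windowSets ω) (k : ℕ) :
    shiftPow π k * windowProj π he B * star (shiftPow π k) =
      windowProj π he (intTranslate (-k) B) := by
  rw [← iterate_conjShift_windowProj π he hB]
  induction k with
  | zero => simp [shiftPow, star_proj, he, mul_proj_univ π he]
  | succ k ih =>
    rw [Function.iterate_succ_apply', ← ih, conjShift_apply, shiftPow, star_mul]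
    simp only [mul_assoc]

/-- The elements `u^k q u^{-l}`, where `u = shiftUnitary π` and `q` is one of the projections
`windowProj`. -/
def monomials : Set A :=
  {x | ∃ k l : ℕ, ∃ B ∈ windowSets ω, x = shiftPow π k * windowProj π he B * star (shiftPow π l)}

theorem star_mem_monomials {x : A} (hx : x ∈ monomials π he) : star x ∈ monomials π he := by
  obtain ⟨k, l, B, hB, rfl⟩ := hx
  refine ⟨l, k, B, hB, ?_⟩
  rw [star_mul, star_mul, star_star, star_windowProj, mul_assoc]

/-- For the inner exponents l and l + m, the product is u^{k+m} q_{(B+m) ∩ C} u^{-l'}, because q_B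
u^m = u^m q_{B+m}. The opposite order of exponents follows by taking adjoints. -/
theorem mul_mem_monomials {x y : A} (hx : x ∈ monomials π he) (hy : y ∈ monomials π he) :
    x * y ∈ monomials π he := by
  have aux (k l m l' : ℕ) (B C : Set ℤ) (hB : B ∈ windowSets ω) (hC : C ∈ windowSets ω) :
      shiftPow π k * windowProj π he B * star (shiftPow π l) *
        (shiftPow π (l + m) * windowProj π he C * star (shiftPow π l')) ∈ monomials π he := by
    refine ⟨k + m, l', intTranslate m B ∩ C,
      inter_mem_windowSets (intTranslate_mem_windowSets hB m) hC, ?_⟩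
    rw [← windowProj_mul π he (intTranslate_mem_windowSets hB m) hC, shiftPow_add π he,
      shiftPow_add π he]
    calc _ = shiftPow π k * windowProj π he B * ((star (shiftPow π l) * shiftPow π l) *
          (shiftPow π m * windowProj π he C * star (shiftPow π l'))) := by simp only [mul_assoc]
      _ = shiftPow π k * (windowProj π he B * shiftPow π m) * windowProj π he C *
          star (shiftPow π l') := by rw [star_shiftPow_mul π he, he]; simp only [mul_assoc]
      _ = _ := by rw [windowProj_mul_shiftPow π he hB]; simp only [mul_assoc]
  obtain ⟨k, l, B, hB, rfl⟩ := hx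
  obtain ⟨k', l', C, hC, rfl⟩ := hy
  rcases le_total l k' with h | h
  · obtain ⟨m, rfl⟩ := Nat.exists_eq_add_of_le h
    exact aux k l m l' B C hB hC
  · obtain ⟨m, rfl⟩ := Nat.exists_eq_add_of_le h
    have := star_mem_monomials π he (aux l' k' m k C B hC hB)
    simpa only [star_mul, star_star, star_windowProj, mul_assoc] using this

theorem proj_mem_monomials {B : Set ℤ} (hB : B ∈ (sequenceGraph ω).Ebar) :
    proj π B ∈ monomials π he :=
  ⟨0, 0, B, mem_windowSets_of_mem_Ebar hB, by
    rw [shiftPow, star_proj, he, mul_proj_univ π he, windowProj_of_mem_Ebar π he hB]⟩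

theorem s_mem_monomials (a : 𝓐) : π.s a ∈ monomials π he :=
  ⟨1, 0, _, mem_windowSets_of_mem_Ebar (range_singleton_mem_Ebar a), by
    simp only [shiftPow]
    rw [star_proj, mul_proj_univ π he, mul_proj_univ π he,
      windowProj_of_mem_Ebar π he (range_singleton_mem_Ebar a), shiftUnitary_mul_proj_range]⟩

theorem adjoin_le_span_monomials {x : A}
    (hx : x ∈ NonUnitalStarAlgebra.adjoin ℂ (Set.range π.s ∪ Set.range π.p)) :
    x ∈ Submodule.span ℂ (monomials π he) := by
  induction hx using NonUnitalStarAlgebra.adjoin_induction with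
  | mem x hx =>
    refine Submodule.subset_span ?_
    rcases hx with ⟨a, rfl⟩ | ⟨B, rfl⟩
    · exact s_mem_monomials π he a
    · rw [← proj_of_mem π B.2]
      exact proj_mem_monomials π he B.2
  | add x y _ _ h1 h2 => exact add_mem h1 h2
  | zero => exact zero_mem _
  | mul x y hx hy h1 h2 =>
    clear hx hy
    induction h1, h2 using Submodule.span_induction₂ with
    | mem_mem x y hx hy => exact Submodule.subset_span (mul_mem_monomials π he hx hy)
    | zero_left y hy => simp
    | zero_right x hx => simp
    | add_left x y z _ _ _ h1 h2 => rw [add_mul]; exact add_mem h1 h2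
    | add_right x y z _ _ _ h1 h2 => rw [mul_add]; exact add_mem h1 h2
    | smul_left r x y _ _ h => rw [smul_mul_assoc]; exact Submodule.smul_mem _ r h
    | smul_right r x y _ _ h => rw [mul_smul_comm]; exact Submodule.smul_mem _ r h
  | smul r x _ h => exact Submodule.smul_mem _ r h
  | star x hx h =>
    clear hx
    induction h using Submodule.span_induction with
    | mem x hx => exact Submodule.subset_span (star_mem_monomials π he hx)
    | zero => simp
    | add x y _ _ h1 h2 => rw [star_add]; exact add_mem h1 h2
    | smul r x _ h => rw [star_smul]; exact Submodule.smul_mem _ _ h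

/-! ### Averaging over the roots of unity -/

variable {γ : Circle → A ≃⋆ₐ[ℂ] A}

/-- The average of `γ_z x` over the `N`-th roots of unity `z`. -/
noncomputable def rootAverage (γ : Circle → A ≃⋆ₐ[ℂ] A) (N : ℕ) (x : A) : A :=
  (N : ℂ)⁻¹ • ∑ j ∈ Finset.range N, γ (Circle.exp (2 * Real.pi / N) ^ j) x

theorem rootAverage_of_fixed {N : ℕ} (hN : N ≠ 0) {x : A} (hx : ∀ z, γ z x = x) :
    rootAverage γ N x = x := by
  simp only [rootAverage, hx, Finset.sum_const, Finset.card_range]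
  rw [← Nat.cast_smul_eq_nsmul ℂ, smul_smul, inv_mul_cancel₀ (by exact_mod_cast hN), one_smul]

theorem rootAverage_add (N : ℕ) (x y : A) :
    rootAverage γ N (x + y) = rootAverage γ N x + rootAverage γ N y := by
  simp only [rootAverage, map_add, Finset.sum_add_distrib, smul_add]

theorem rootAverage_smul (N : ℕ) (c : ℂ) (x : A) :
    rootAverage γ N (c • x) = c • rootAverage γ N x := by
  simp only [rootAverage, map_smul, ← Finset.smul_sum]
  rw [smul_comm]

theorem norm_rootAverage_le (N : ℕ) (x : A) : ‖rootAverage γ N x‖ ≤ ‖x‖ := by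
  rcases eq_or_ne N 0 with rfl | hN
  · simp [rootAverage]
  have hN' : (0 : ℝ) < N := by exact_mod_cast Nat.pos_of_ne_zero hN
  rw [rootAverage, norm_smul, norm_inv, Complex.norm_natCast, inv_mul_le_iff₀ hN']
  refine (norm_sum_le _ _).trans ((Finset.sum_le_sum fun j _ =>
    NonUnitalStarAlgHom.norm_apply_le (γ _) x).trans ?_)
  simp

variable (hγs : ∀ z a, γ z (π.s a) = (z : ℂ) • π.s a) (hγp : ∀ z B, γ z (π.p B) = π.p B)

include hγs in
theorem gauge_shiftUnitary (z : Circle) :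
    γ z (shiftUnitary π) = (z : ℂ) • shiftUnitary π := by
  simp only [shiftUnitary, map_sum, hγs, Finset.smul_sum]

include hγp in
theorem gauge_proj (z : Circle) (B : Set ℤ) : γ z (proj π B) = proj π B := by
  unfold proj
  split_ifs with h
  · exact hγp z _
  · exact map_zero _

include hγs hγp in
theorem gauge_shiftPow (z : Circle) (k : ℕ) :
    γ z (shiftPow π k) = (z : ℂ) ^ k • shiftPow π k := by
  induction k with
  | zero => simp [shiftPow, gauge_proj π hγp]
  | succ k ih =>
    rw [shiftPow, map_mul, ih, gauge_shiftUnitary π hγs, smul_mul_smul_comm, pow_succ']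

include hγs hγp in
theorem gauge_windowProj (z : Circle) (B : Set ℤ) :
    γ z (windowProj π he B) = windowProj π he B := by
  have hz : (z : ℂ) * star (z : ℂ) = 1 := by
    rw [← starRingEnd_apply, Complex.mul_conj', Circle.norm_coe, Complex.ofReal_one, one_pow]
  have aux (k : ℕ) (x : A) (hx : γ z x = x) :
      γ z ((conjShift π he)^[k] x) = (conjShift π he)^[k] x := by
    induction k with
    | zero => simpa using hx
    | succ k ih =>
      rw [Function.iterate_succ_apply', conjShift_apply, map_mul, map_mul, map_star, ih,
        gauge_shiftUnitary π hγs, star_smul, smul_mul_assoc, smul_mul_assoc, mul_smul_comm,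
        smul_smul, hz, one_smul]
  unfold windowProj
  split_ifs with h
  · exact aux _ _ (gauge_proj π hγp z _)
  · exact map_zero _

include hγs hγp in
theorem gauge_of_mem_windowSpan (z : Circle) {x : A} (hx : x ∈ windowSpan π he) : γ z x = x := by
  induction hx using Submodule.span_induction with
  | mem x hx =>
    obtain ⟨B, -, rfl⟩ := hx
    exact gauge_windowProj π he hγs hγp z B
  | zero => exact map_zero _
  | add x y _ _ h1 h2 => rw [map_add, h1, h2]
  | smul r x _ h => rw [map_smul, h]

-- The gauge action scales u^k q_B u^{-l} by z^{k-l}. For k = l the monomial is q_{B-k}; for k ≠ l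
-- its average over the N-th roots of unity is zero once N > max k l. The bound on N depends on the
-- monomials that occur in x.
include hγs hγp in
theorem eventually_rootAverage_mem {x : A} (hx : x ∈ Submodule.span ℂ (monomials π he)) :
    ∀ᶠ N in atTop, rootAverage γ N x ∈ windowSpan π he := by
  induction hx using Submodule.span_induction with
  | zero => exact Eventually.of_forall fun N => by simp [rootAverage]
  | add x y _ _ h1 h2 =>
    filter_upwards [h1, h2] with N h1 h2
    rw [rootAverage_add]
    exact add_mem h1 h2
  | smul r x _ h =>
    filter_upwards [h] with N h
    rw [rootAverage_smul]
    exact Submodule.smul_mem _ r h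
  | mem x hx =>
    obtain ⟨k, l, B, hB, rfl⟩ := hx
    filter_upwards [eventually_gt_atTop (max k l)] with N hN
    have hN0 : N ≠ 0 := by omega
    rcases eq_or_ne k l with rfl | hkl
    · have hmem := windowProj_mem_windowSpan π he (intTranslate_mem_windowSets hB (-k))
      rw [shiftPow_mul_windowProj_mul_star π he hB, rootAverage_of_fixed hN0 fun z =>
        gauge_of_mem_windowSpan π he hγs hγp z hmem]
      exact hmem
    · have hζ : IsPrimitiveRoot ((Circle.exp (2 * Real.pi / N) : Circle) : ℂ) N := by
        have := Complex.isPrimitiveRoot_exp N hN0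
        rw [Circle.coe_exp]
        convert this using 2
        push_cast
        ring
      set ζ : Circle := Circle.exp (2 * Real.pi / N) with hζdef
      have hconj : (ζ : ℂ) * star (ζ : ℂ) = 1 := by
        rw [← starRingEnd_apply, Complex.mul_conj', Circle.norm_coe, Complex.ofReal_one, one_pow]
      have hterm (j : ℕ) : γ (ζ ^ j) (shiftPow π k * windowProj π he B * star (shiftPow π l)) =
          ((ζ : ℂ) ^ k * star (ζ : ℂ) ^ l) ^ j •
            (shiftPow π k * windowProj π he B * star (shiftPow π l)) := by
        rw [map_mul, map_mul, map_star, gauge_shiftPow π hγs hγp, gauge_shiftPow π hγs hγp,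
          gauge_windowProj π he hγs hγp, star_smul, smul_mul_assoc, smul_mul_smul_comm,
          Circle.coe_pow, star_pow, star_pow]
        congr 1
        ring
      -- Otherwise ζ^k = ζ^l with k, l < N, against primitivity of ζ; the geometric sum below is
      -- then zero.
      have hne : (ζ : ℂ) ^ k * star (ζ : ℂ) ^ l ≠ 1 := by
        intro h
        apply hkl
        refine hζ.pow_inj (by omega) (by omega) ?_
        calc (ζ : ℂ) ^ k = ζ ^ k * ((ζ : ℂ) * star (ζ : ℂ)) ^ l := by rw [hconj]; simp
          _ = (ζ ^ k * star (ζ : ℂ) ^ l) * ζ ^ l := by ring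
          _ = _ := by rw [h, one_mul]
      have hpow : ((ζ : ℂ) ^ k * star (ζ : ℂ) ^ l) ^ N = 1 := by
        calc ((ζ : ℂ) ^ k * star (ζ : ℂ) ^ l) ^ N = ((ζ : ℂ) ^ N) ^ k * star ((ζ : ℂ) ^ N) ^ l := by
              rw [star_pow]; ring
          _ = 1 := by simp [hζ.pow_eq_one]
      have hsum : ∑ j ∈ Finset.range N, ((ζ : ℂ) ^ k * star (ζ : ℂ) ^ l) ^ j = 0 := by
        rw [geom_sum_eq hne, hpow, sub_self, zero_div]
      rw [rootAverage, ← hζdef]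
      simp only [hterm]
      rw [← Finset.sum_smul, hsum, zero_smul, smul_zero]
      exact zero_mem _

include hγs hγp in
/-- The fixed points of the gauge action are limits of elements of `windowSpan`. -/
theorem mem_closure_windowSpan_of_fixed
    (hgen : Dense (NonUnitalStarAlgebra.adjoin ℂ (Set.range π.s ∪ Set.range π.p) : Set A))
    {x : A} (hx : ∀ z, γ z x = x) : x ∈ closure (windowSpan π he : Set A) := by
  rw [Metric.mem_closure_iff]
  intro ε hε
  obtain ⟨y, hy, hxy⟩ := Metric.mem_closure_iff.1 (hgen x) ε hε
  obtain ⟨N, hN, hN0⟩ := ((eventually_rootAverage_mem π he hγs hγp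
    (adjoin_le_span_monomials π he hy)).and (eventually_gt_atTop 0)).exists
  refine ⟨_, hN, lt_of_le_of_lt ?_ hxy⟩
  -- Averaging fixes x and is contractive, so the average of y is no farther from x than y is.
  have h : x - rootAverage γ N y = rootAverage γ N (x - y) := by
    have := rootAverage_add (γ := γ) N (x - y) y
    rw [sub_add_cancel, rootAverage_of_fixed hN0.ne' hx] at this
    nth_rewrite 1 [this]
    abel
  rw [dist_eq_norm, dist_eq_norm, h]
  exact norm_rootAverage_le N _

end Averaging

/-! ### The regular representation on `ℓ²(ℤ)` -/

section Regular

/-- The Hilbert space `ℓ²(ℤ)`, in the universe `w`. -/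
abbrev EllTwo : Type w := lp (fun _ : ULift.{w} ℤ => ℂ) 2

/-- Translation on the index set of `EllTwo`. -/
def indexTranslate (k : ℤ) : ULift.{w} ℤ ≃ ULift.{w} ℤ :=
  Equiv.ulift.trans ((Equiv.addRight k).trans Equiv.ulift.symm)

theorem indexTranslate_apply (k : ℤ) (i : ULift.{w} ℤ) : indexTranslate k i = ⟨i.down + k⟩ := rfl

open Classical in
/-- The function `n ↦ x (n + k)`, cut down to the set `B`. -/
noncomputable def cutShiftFun (B : Set ℤ) (k : ℤ) (x : ULift.{w} ℤ → ℂ) (i : ULift.{w} ℤ) : ℂ :=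
  if i.down ∈ B then x (indexTranslate k i) else 0

theorem norm_cutShiftFun_le (B : Set ℤ) (k : ℤ) (x : ULift.{w} ℤ → ℂ) (i : ULift.{w} ℤ) :
    ‖cutShiftFun B k x i‖ ≤ ‖x (indexTranslate k i)‖ := by
  unfold cutShiftFun
  split_ifs <;> simp

theorem summable_norm_rpow (x : EllTwo.{w}) : Summable fun i => ‖x i‖ ^ (2 : ℝ≥0∞).toReal :=
  (lp.memℓp x).summable (by norm_num)

theorem summable_cutShiftFun (B : Set ℤ) (k : ℤ) (x : EllTwo.{w}) :
    Summable fun i => ‖cutShiftFun B k x i‖ ^ (2 : ℝ≥0∞).toReal := by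
  refine Summable.of_nonneg_of_le (fun i => by positivity) (fun i => ?_)
    ((indexTranslate k).summable_iff.2 (summable_norm_rpow x))
  exact Real.rpow_le_rpow (norm_nonneg _) (norm_cutShiftFun_le B k x i) (by norm_num)

/-- The partial isometry of `ℓ²(ℤ)` that shifts by `k` and then cuts down to `B`. -/
noncomputable def cutShift (B : Set ℤ) (k : ℤ) : EllTwo.{w} →L[ℂ] EllTwo.{w} :=
  LinearMap.mkContinuous
    { toFun := fun x => ⟨cutShiftFun B k x, memℓp_gen (summable_cutShiftFun B k x)⟩
      map_add' := fun x y => lp.ext <| funext fun i => by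
        simp only [lp.coeFn_add, Pi.add_apply, cutShiftFun]
        split_ifs <;> simp
      map_smul' := fun c x => lp.ext <| funext fun i => by
        simp only [lp.coeFn_smul, Pi.smul_apply, cutShiftFun, RingHom.id_apply]
        split_ifs <;> simp } 1 fun x => by
    rw [one_mul]
    refine lp.norm_le_of_tsum_le (by norm_num) (norm_nonneg x) ?_
    rw [lp.norm_rpow_eq_tsum (by norm_num),
      ← (indexTranslate k).tsum_eq fun i => ‖x i‖ ^ (2 : ℝ≥0∞).toReal]
    refine (summable_cutShiftFun B k x).tsum_le_tsum (fun i => ?_)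
      ((indexTranslate k).summable_iff.2 (summable_norm_rpow x))
    exact Real.rpow_le_rpow (norm_nonneg _) (norm_cutShiftFun_le B k x i) (by norm_num)

open Classical in
theorem cutShift_apply (B : Set ℤ) (k : ℤ) (x : EllTwo.{w}) (n : ℤ) :
    cutShift B k x ⟨n⟩ = if n ∈ B then x ⟨n + k⟩ else 0 := rfl

theorem ellTwo_ext {x y : EllTwo.{w}} (h : ∀ n : ℤ, x ⟨n⟩ = y ⟨n⟩) : x = y :=
  lp.ext <| funext fun i => h i.down

/-- With the formula for adjoints, this reduces most relations of the representation to identities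
between sets of integers. -/
theorem cutShift_mul (B C : Set ℤ) (k l : ℤ) :
    cutShift.{w} B k * cutShift C l = cutShift (B ∩ intTranslate (-k) C) (k + l) := by
  refine ContinuousLinearMap.ext fun x => ellTwo_ext fun n => ?_
  have h : n ∈ B ∩ intTranslate (-k) C ↔ n ∈ B ∧ n + k ∈ C := by simp
  rw [mul_apply_eq_comp, cutShift_apply, cutShift_apply, cutShift_apply, add_assoc]
  by_cases h1 : n ∈ B <;> by_cases h2 : n + k ∈ C <;> simp [h, h1, h2]

theorem star_cutShift (B : Set ℤ) (k : ℤ) :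
    star (cutShift.{w} B k) = cutShift (intTranslate k B) (-k) := by
  symm
  rw [ContinuousLinearMap.star_eq_adjoint, ContinuousLinearMap.eq_adjoint_iff]
  intro x y
  rw [lp.inner_eq_tsum, lp.inner_eq_tsum, ← (indexTranslate k).tsum_eq]
  refine tsum_congr fun i => ?_
  obtain ⟨n⟩ := i
  rw [indexTranslate_apply, cutShift_apply, cutShift_apply]
  have h : n + k ∈ intTranslate k B ↔ n ∈ B := by simp
  rw [add_neg_cancel_right]
  by_cases h1 : n ∈ B <;> simp [h, h1]

theorem cutShift_empty (k : ℤ) : cutShift.{w} ∅ k = 0 := by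
  refine ContinuousLinearMap.ext fun x => ellTwo_ext fun n => ?_
  simp [cutShift_apply]

theorem cutShift_add {B C : Set ℤ} (h : B ∩ C = ∅) (k : ℤ) :
    cutShift.{w} (B ∪ C) k = cutShift B k + cutShift C k := by
  refine ContinuousLinearMap.ext fun x => ellTwo_ext fun n => ?_
  have hn : ¬ (n ∈ B ∧ n ∈ C) := fun hn => by
    have : n ∈ B ∩ C := hn
    simp [h] at this
  rw [add_apply, lp.coeFn_add, Pi.add_apply, cutShift_apply, cutShift_apply,
    cutShift_apply]
  by_cases h1 : n ∈ B <;> by_cases h2 : n ∈ C <;> simp_all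

theorem cutShift_biUnion {ι : Type*} (t : Finset ι) (F : ι → Set ℤ)
    (hd : ∀ i j, i ≠ j → F i ∩ F j = ∅) (k : ℤ) :
    cutShift.{w} (⋃ i ∈ t, F i) k = ∑ i ∈ t, cutShift (F i) k := by
  classical
  induction t using Finset.induction_on with
  | empty => simpa using cutShift_empty k
  | insert i t hi ih =>
    rw [Finset.set_biUnion_insert, Finset.sum_insert hi, cutShift_add, ih]
    rw [Set.inter_iUnion₂]
    simp only [Set.iUnion_eq_empty]
    intro j hj
    exact hd i j fun h => hi (h ▸ hj)

variable {𝓐 : Type u} [Fintype 𝓐] (ω : ℤ → 𝓐)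

/-- The representation of the labeled space of `ω` on `ℓ²(ℤ)`. -/
noncomputable def regularRep :
    (sequenceGraph ω).Representation (EllTwo.{w} →L[ℂ] EllTwo.{w}) where
  p A := cutShift A 0
  -- Moves the basis vector at the range n + 1 of an edge labeled a back to its source n.
  s a := cutShift {n | ω n = a} 1
  isStarProjection_p A := by
    refine ⟨?_, ?_⟩
    · rw [IsIdempotentElem, cutShift_mul]; simp
    · rw [IsSelfAdjoint, star_cutShift]; simp
  partialIsometry_s a := by
    rw [star_cutShift, cutShift_mul, cutShift_mul]
    congr 1
    ext n
    simp
  p_empty := cutShift_empty 0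
  p_mul_p A A' := by rw [cutShift_mul]; simp
  p_union A A' := by
    refine ContinuousLinearMap.ext fun x => ellTwo_ext fun n => ?_
    simp only [sub_apply, add_apply, lp.coeFn_sub,
      lp.coeFn_add, Pi.sub_apply, Pi.add_apply, cutShift_apply]
    by_cases h1 : n ∈ (A : Set ℤ) <;> by_cases h2 : n ∈ (A' : Set ℤ) <;> simp [h1, h2]
  p_mul_s A a := by
    rw [cutShift_mul, cutShift_mul]
    congr 1
    ext n
    simp [mem_relRange_singleton]
  star_s_mul_s a := by
    rw [star_cutShift, cutShift_mul]
    congr 1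
    ext n
    simp [mem_range_singleton]
  star_s_mul_s_of_ne a b h := by
    rw [star_cutShift, cutShift_mul, ← cutShift_empty 0]
    congr 1
    ext n
    simp
    grind
  p_eq_sum A := by
    have h (a : 𝓐) : cutShift.{w} {n | ω n = a} 1 *
        cutShift ((sequenceGraph ω).relRange A [a]) 0 * star (cutShift {n | ω n = a} 1) =
        cutShift {n | n ∈ (A : Set ℤ) ∧ ω n = a} 0 := by
      rw [star_cutShift, cutShift_mul, cutShift_mul]
      congr 1
      ext n
      simp [mem_relRange_singleton]
      tauto
    simp only [h]
    rw [← cutShift_biUnion]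
    · congr 1
      ext n
      simp only [Set.Finite.mem_toFinset, mem_labelsFrom, Set.mem_iUnion, Set.mem_ofPred_eq,
        exists_prop]
      constructor
      · exact fun hn => ⟨ω n, ⟨n, hn, rfl⟩, hn, rfl⟩
      · rintro ⟨-, -, hn, -⟩
        exact hn
    · intro a b hab
      ext n
      simp only [Set.mem_inter_iff, Set.mem_ofPred_eq, Set.mem_empty_iff_false, iff_false]
      rintro ⟨⟨-, rfl⟩, -, h'⟩
      exact hab h'

theorem shiftUnitary_regularRep : shiftUnitary (regularRep.{u, w} ω) = cutShift Set.univ 1 := by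
  have : (Set.univ : Set ℤ) = ⋃ a ∈ (Finset.univ : Finset 𝓐), {n | ω n = a} := by
    ext n; simp
  rw [this, cutShift_biUnion]
  · rfl
  · intro a b hab
    ext n
    simp only [Set.mem_inter_iff, Set.mem_ofPred_eq, Set.mem_empty_iff_false, iff_false]
    rintro ⟨rfl, h'⟩
    exact hab h'

variable {ω} {A : Type*} [NonUnitalCStarAlgebra A] (π : (sequenceGraph ω).Representation A)
  (he : ∀ x, proj π Set.univ * x = x) (Φ : A →⋆ₙₐ[ℂ] (EllTwo.{w} →L[ℂ] EllTwo.{w}))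

/-- The image of u is the bilateral shift, and conjugation by it undoes the translation in the
definition of q_B. -/
theorem map_windowProj (hs : ∀ a, Φ (π.s a) = (regularRep ω).s a)
    (hp : ∀ B, Φ (π.p B) = (regularRep ω).p B) {B : Set ℤ} (hB : B ∈ windowSets ω) :
    Φ (windowProj π he B) = cutShift B 0 := by
  have hu : Φ (shiftUnitary π) = cutShift Set.univ 1 := by
    rw [← shiftUnitary_regularRep ω]
    simp only [shiftUnitary, map_sum, hs]
  obtain ⟨k, hk⟩ := hB
  rw [windowProj_eq π he hk]
  have aux (k : ℕ) (x : A) (C : Set ℤ) (hx : Φ x = cutShift C 0) :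
      Φ ((conjShift π he)^[k] x) = cutShift (intTranslate (-k) C) 0 := by
    induction k with
    | zero => simpa using hx
    | succ k ih =>
      rw [Function.iterate_succ_apply', conjShift_apply, map_mul, map_mul, map_star, ih, hu,
        star_cutShift, cutShift_mul, cutShift_mul]
      congr 1
      ext n
      simp only [Set.univ_inter, mem_intTranslate, Nat.cast_succ, Set.mem_inter_iff,
        Set.mem_univ, and_true]
      rw [show n - -1 - -(k : ℤ) = n - -((k : ℤ) + 1) by ring]
  rw [aux k _ (intTranslate k B) (by rw [proj_of_mem π hk, hp]; rfl), intTranslate_intTranslate,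
    add_neg_cancel, intTranslate_zero]

open Classical in
/-- The diagonal matrix coefficients of an operator on `ℓ²(ℤ)`. -/
noncomputable def diagonal : (EllTwo.{w} →L[ℂ] EllTwo.{w}) →ₗ[ℂ] (ℤ → ℂ) where
  toFun T n := T (lp.single 2 ⟨n⟩ 1) ⟨n⟩
  map_add' _ _ := rfl
  map_smul' _ _ := rfl

open Classical in
theorem diagonal_apply (T : EllTwo.{w} →L[ℂ] EllTwo.{w}) (n : ℤ) :
    diagonal T n = T (lp.single 2 ⟨n⟩ 1) ⟨n⟩ := rfl

theorem norm_diagonal_le (T : EllTwo.{w} →L[ℂ] EllTwo.{w}) (n : ℤ) : ‖diagonal T n‖ ≤ ‖T‖ := by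
  classical
  refine (lp.norm_apply_le_norm (by norm_num) _ _).trans ((T.le_opNorm _).trans ?_)
  rw [lp.norm_single (by norm_num)]
  simp

theorem diagonal_cutShift (B : Set ℤ) : diagonal (cutShift.{w} B 0) = B.indicator 1 := by
  classical
  funext n
  change cutShift B 0 (lp.single 2 ⟨n⟩ 1) ⟨n⟩ = _
  rw [cutShift_apply]
  simp [Set.indicator_apply]

end Regular

open Topology

open scoped BoundedContinuousFunction

/-! ### The orbit of the sequence -/

section Orbit

variable {𝓐 : Type u} [TopologicalSpace 𝓐]

theorem shift_zpow_apply (n : ℤ) (x : ℤ → 𝓐) (k : ℤ) :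
    (shift ^ n : (ℤ → 𝓐) ≃ₜ (ℤ → 𝓐)) x k = x (k + n) := by
  induction n generalizing x with
  | zero => simp
  | succ n ih =>
    rw [zpow_add_one]
    refine (ih (shift x)).trans ?_
    change x (k + n + 1) = _
    rw [add_assoc]
  | pred n ih =>
    rw [zpow_sub_one]
    refine (ih (shift.symm x)).trans ?_
    change x (k + -n - 1) = _
    rw [add_sub_assoc]

variable (ω : ℤ → 𝓐)

/-- The point `Tⁿ ω` of the orbit closure. -/
def orbitPoint (n : ℤ) : orbitClosure ω :=
  ⟨(shift ^ n : (ℤ → 𝓐) ≃ₜ (ℤ → 𝓐)) ω, subset_closure ⟨n, rfl⟩⟩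

theorem orbitPoint_apply (n k : ℤ) : (orbitPoint ω n : ℤ → 𝓐) k = ω (k + n) :=
  shift_zpow_apply n ω k

theorem denseRange_orbitPoint : DenseRange (orbitPoint ω) := by
  intro x
  rw [closure_subtype, ← Set.range_comp]
  exact x.2

theorem orbitPoint_mem_cylinder {n t : ℤ} {α : List 𝓐} :
    (orbitPoint ω n : ℤ → 𝓐) ∈ cylinder t α ↔ ω ∈ cylinder (t + n) α := by
  simp only [cylinder, Set.mem_ofPred_eq, orbitPoint_apply]
  refine forall₂_congr fun i hi => ?_
  rw [show t + (i : ℤ) + n = t + n + i by ring]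

theorem isClopen_cylinder [DiscreteTopology 𝓐] (t : ℤ) (α : List 𝓐) :
    IsClopen (cylinder t α : Set (ℤ → 𝓐)) := by
  induction α generalizing t with
  | nil => simpa [cylinder] using isClopen_univ
  | cons a α ih =>
    have h : (cylinder t (a :: α) : Set (ℤ → 𝓐)) =
        (fun x : ℤ → 𝓐 => x t) ⁻¹' {a} ∩ cylinder (t + 1) α := by
      ext x
      simp [mem_cylinder_cons]
    rw [h]
    exact ((isClopen_discrete {a}).preimage (continuous_apply t)).inter (ih _)

/-- The sets {n | Tⁿω ∈ K} with K clopen form a normal accommodating collection, so they include Ē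
by minimality of the latter. They are also stable under all translations, because the shift is a
homeomorphism. -/
theorem exists_isClopen_of_mem_windowSets [DiscreteTopology 𝓐] {B : Set ℤ}
    (hB : B ∈ windowSets ω) :
    ∃ K : Set (ℤ → 𝓐), IsClopen K ∧ ∀ n, n ∈ B ↔ (orbitPoint ω n : ℤ → 𝓐) ∈ K := by
  have key (k : ℤ) (B : Set ℤ)
      (h : ∃ K : Set (ℤ → 𝓐), IsClopen K ∧ ∀ n, n ∈ B ↔ (orbitPoint ω n : ℤ → 𝓐) ∈ K) :
      ∃ K : Set (ℤ → 𝓐), IsClopen K ∧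
        ∀ n, n ∈ intTranslate k B ↔ (orbitPoint ω n : ℤ → 𝓐) ∈ K := by
    obtain ⟨K, hK, h⟩ := h
    refine ⟨(fun x m => x (m - k)) ⁻¹' K, hK.preimage (by fun_prop), fun n => ?_⟩
    rw [mem_intTranslate, h, Set.mem_preimage]
    congr! 1
    funext m
    rw [orbitPoint_apply, orbitPoint_apply]
    congr 1
    ring
  have hacc : (sequenceGraph ω).IsNormalAccommodating
      {B | ∃ K : Set (ℤ → 𝓐), IsClopen K ∧ ∀ n, n ∈ B ↔ (orbitPoint ω n : ℤ → 𝓐) ∈ K} := by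
    have hrel (A : Set ℤ) (hA : ∃ K : Set (ℤ → 𝓐), IsClopen K ∧
        ∀ n, n ∈ A ↔ (orbitPoint ω n : ℤ → 𝓐) ∈ K) (α : List 𝓐) :
        ∃ K : Set (ℤ → 𝓐), IsClopen K ∧
          ∀ n, n ∈ (sequenceGraph ω).relRange A α ↔ (orbitPoint ω n : ℤ → 𝓐) ∈ K := by
      obtain ⟨K, hK, h⟩ := key α.length A hA
      -- A path labeled α that ends at n reads the coordinates of Tⁿω from -|α| to -1.
      refine ⟨K ∩ cylinder (-(α.length : ℤ)) α, hK.inter (isClopen_cylinder _ _), fun n => ?_⟩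
      rw [mem_relRange, Set.mem_inter_iff, ← h, orbitPoint_mem_cylinder, mem_intTranslate,
        neg_add_eq_sub]
    exact
    { empty_mem := ⟨∅, isClopen_empty, fun n => Iff.rfl⟩
      range_mem := fun α _ => hrel _ ⟨Set.univ, isClopen_univ, fun n => by simp⟩ α
      relRange_mem := fun A hA α _ => hrel A hA α
      union_mem := by
        rintro A ⟨K, hK, h⟩ B ⟨K', hK', h'⟩
        exact ⟨K ∪ K', hK.union hK', fun n => or_congr (h n) (h' n)⟩
      inter_mem := by
        rintro A ⟨K, hK, h⟩ B ⟨K', hK', h'⟩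
        exact ⟨K ∩ K', hK.inter hK', fun n => and_congr (h n) (h' n)⟩
      diff_mem := by
        rintro A ⟨K, hK, h⟩ B ⟨K', hK', h'⟩
        exact ⟨K \ K', hK.diff hK', fun n => and_congr (h n) (not_congr (h' n))⟩ }
  obtain ⟨k, hk⟩ := hB
  have := key (-k) _ (hk _ hacc)
  rwa [intTranslate_intTranslate, add_neg_cancel, intTranslate_zero] at this

/-- The characteristic function of a clopen set, as a continuous function on the orbit closure. -/
noncomputable def clopenIndicator {K : Set (ℤ → 𝓐)} (hK : IsClopen K) : C(orbitClosure ω, ℂ) where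
  toFun x := K.indicator 1 (x : ℤ → 𝓐)
  continuous_toFun := ((IsClopen.continuous_indicator hK continuous_one)).comp
    continuous_subtype_val

/-- Restriction of continuous functions from the orbit closure to the orbit. -/
noncomputable def restrictOrbit [CompactSpace (orbitClosure ω)] :
    C(orbitClosure ω, ℂ) →ₗᵢ[ℂ] (ℤ →ᵇ ℂ) where
  toFun f := BoundedContinuousFunction.ofNormedAddCommGroupDiscrete
    (fun n => f (orbitPoint ω n)) ‖f‖ fun n => f.norm_coe_le_norm _
  map_add' f g := rfl
  map_smul' c f := rfl
  norm_map' f := by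
    refine le_antisymm ?_ ?_
    · exact (BoundedContinuousFunction.norm_le (norm_nonneg f)).2 fun n => f.norm_coe_le_norm _
    -- The bound on the orbit extends to the orbit closure by density.
    · refine (f.norm_le (norm_nonneg _)).2 fun x => ?_
      refine (denseRange_orbitPoint ω).induction_on
        (p := fun x => ‖f x‖ ≤ ‖BoundedContinuousFunction.ofNormedAddCommGroupDiscrete
          (fun n => f (orbitPoint ω n)) ‖f‖ fun n => f.norm_coe_le_norm _‖) x
        (isClosed_le (by fun_prop) continuous_const) fun n => ?_
      exact BoundedContinuousFunction.norm_coe_le_norm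
        (BoundedContinuousFunction.ofNormedAddCommGroupDiscrete
          (fun n => f (orbitPoint ω n)) ‖f‖ fun n => f.norm_coe_le_norm _) n

theorem restrictOrbit_apply [CompactSpace (orbitClosure ω)] (f : C(orbitClosure ω, ℂ)) (n : ℤ) :
    restrictOrbit ω f n = f (orbitPoint ω n) := rfl

end Orbit

/-! ### The fixed-point algebra -/

/-- The diagonal matrix coefficients of an operator on `ℓ²(ℤ)`, as a bounded function. -/
noncomputable def boundedDiagonal : (EllTwo.{w} →L[ℂ] EllTwo.{w}) →ₗ[ℂ] (ℤ →ᵇ ℂ) where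
  toFun T := BoundedContinuousFunction.ofNormedAddCommGroupDiscrete (diagonal T) ‖T‖
    (norm_diagonal_le T)
  map_add' _ _ := by ext; simp
  map_smul' _ _ := by ext; simp

theorem boundedDiagonal_apply (T : EllTwo.{w} →L[ℂ] EllTwo.{w}) (n : ℤ) :
    boundedDiagonal T n = diagonal T n := rfl

theorem norm_boundedDiagonal_le (T : EllTwo.{w} →L[ℂ] EllTwo.{w}) : ‖boundedDiagonal T‖ ≤ ‖T‖ :=
  (BoundedContinuousFunction.norm_le (norm_nonneg T)).2 (norm_diagonal_le T)

theorem diagonal_star (T : EllTwo.{w} →L[ℂ] EllTwo.{w}) (n : ℤ) :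
    diagonal (star T) n = star (diagonal T n) := by
  classical
  have h (S : EllTwo.{w} →L[ℂ] EllTwo.{w}) :
      diagonal S n = inner ℂ (lp.single 2 ⟨n⟩ 1 : EllTwo.{w}) (S (lp.single 2 ⟨n⟩ 1)) := by
    rw [lp.inner_single_left]
    simp [diagonal]
    congr!
  rw [h, h, ContinuousLinearMap.star_eq_adjoint, ContinuousLinearMap.adjoint_inner_right,
    ← inner_conj_symm]
  rfl

section Fixed

variable {𝓐 : Type u} [Fintype 𝓐] {ω : ℤ → 𝓐} {A : Type*} [NonUnitalCStarAlgebra A]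
  (π : (sequenceGraph ω).Representation A)

theorem proj_univ_mul_of_dense
    (hgen : Dense (NonUnitalStarAlgebra.adjoin ℂ (Set.range π.s ∪ Set.range π.p) : Set A))
    (x : A) : proj π Set.univ * x = x := by
  have hcl : IsClosed {x | proj π Set.univ * x = x} :=
    isClosed_eq (by fun_prop) continuous_id
  refine closure_minimal (fun y hy => ?_) hcl (hgen x)
  have hpB (B : (sequenceGraph ω).Ebar) : proj π Set.univ * π.p B = π.p B := by
    rw [← proj_of_mem π B.2, proj_mul_proj π univ_mem_Ebar B.2, Set.univ_inter]
  -- The induction needs both sides, since the adjoint exchanges them.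
  suffices h : proj π Set.univ * y = y ∧ y * proj π Set.univ = y from h.1
  induction hy using NonUnitalStarAlgebra.adjoin_induction with
  | mem y hy =>
    rcases hy with ⟨a, rfl⟩ | ⟨B, rfl⟩
    · constructor
      · rw [proj_mul_s π univ_mem_Ebar]
        have := s_mul_proj π (intTranslate_one_mem_Ebar (univ_mem_Ebar (ω := ω))) a
        rw [this]
        have h : (sequenceGraph ω).range [a] ∩ intTranslate 1 Set.univ =
          (sequenceGraph ω).range [a] := Set.inter_univ _
        rw [h, s_mul_proj_range]
      · rw [s_mul_proj π univ_mem_Ebar, Set.inter_univ, s_mul_proj_range]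
    · refine ⟨hpB B, ?_⟩
      rw [← proj_of_mem π B.2, proj_mul_proj π B.2 univ_mem_Ebar, Set.inter_univ]
  | add x y _ _ h1 h2 => exact ⟨by rw [mul_add, h1.1, h2.1], by rw [add_mul, h1.2, h2.2]⟩
  | zero => simp
  | mul x y _ _ h1 h2 => exact ⟨by rw [← mul_assoc, h1.1], by rw [mul_assoc, h2.2]⟩
  | smul r x _ h => exact ⟨by rw [mul_smul_comm, h.1], by rw [smul_mul_assoc, h.2]⟩
  | star x _ h =>
    refine ⟨?_, ?_⟩
    · simpa [star_proj] using congrArg star h.2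
    · simpa [star_proj] using congrArg star h.1

variable (he : ∀ x, proj π Set.univ * x = x) {Φ : A →⋆ₙₐ[ℂ] (EllTwo.{w} →L[ℂ] EllTwo.{w})}

theorem continuous_starAlgHom {B C : Type*} [NonUnitalCStarAlgebra B] [NonUnitalCStarAlgebra C]
    (φ : B →⋆ₙₐ[ℂ] C) : Continuous φ :=
  AddMonoidHomClass.continuous_of_bound φ 1 fun x => by
    simpa using NonUnitalStarAlgHom.norm_apply_le φ x

theorem continuous_boundedDiagonal : Continuous boundedDiagonal.{w} :=
  AddMonoidHomClass.continuous_of_bound boundedDiagonal.{w} 1 fun x => by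
    simpa using norm_boundedDiagonal_le x

variable (hs : ∀ a, Φ (π.s a) = (regularRep ω).s a) (hp : ∀ B, Φ (π.p B) = (regularRep ω).p B)
include hs hp

/-- Faithfulness of ℓ²(ℤ) on the fixed points: the estimate on the span survives limits because both
sides are continuous. -/
theorem norm_le_norm_boundedDiagonal {x : A} (hx : x ∈ closure (windowSpan π he : Set A)) :
    ‖x‖ ≤ ‖boundedDiagonal (Φ x)‖ := by
  have hcl : IsClosed {x | ‖x‖ ≤ ‖boundedDiagonal (Φ x)‖} :=
    isClosed_le continuous_norm
      (continuous_boundedDiagonal.comp (continuous_starAlgHom Φ)).norm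
  refine closure_minimal (fun y hy => ?_) hcl hx
  refine norm_le_of_mem_windowSpan π he hy
    (ev := diagonal ∘ₗ (Φ : A →ₗ[ℂ] (EllTwo.{w} →L[ℂ] EllTwo.{w})))
    (fun B hB => ?_) (norm_nonneg _) fun n => (boundedDiagonal (Φ y)).norm_coe_le_norm n
  change diagonal (Φ _) = _
  rw [map_windowProj π he Φ hs hp hB, diagonal_cutShift]

-- These elements act as diagonal operators: the q_B do, and the eigenvector equation is linear and
-- closed. Taking diagonal coefficients is not multiplicative in general, but it is on such
-- operators.
open Classical in
theorem map_apply_single {x : A} (hx : x ∈ closure (windowSpan π he : Set A)) (n : ℤ) :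
    Φ x (lp.single 2 ⟨n⟩ 1) = diagonal (Φ x) n • (lp.single 2 ⟨n⟩ 1 : EllTwo.{w}) := by
  have hc : Continuous fun x => diagonal (Φ x) n :=
    ((continuous_eval_const n).comp continuous_boundedDiagonal).comp
      (continuous_starAlgHom Φ)
  have hcl : IsClosed {x | Φ x (lp.single 2 ⟨n⟩ 1) =
      diagonal (Φ x) n • (lp.single 2 ⟨n⟩ 1 : EllTwo.{w})} :=
    isClosed_eq ((continuous_starAlgHom Φ).clm_apply continuous_const)
      (hc.smul continuous_const)
  refine closure_minimal (fun y hy => ?_) hcl hx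
  induction hy using Submodule.span_induction with
  | mem y hy =>
    obtain ⟨B, hB, rfl⟩ := hy
    simp only [Set.mem_ofPred_eq]
    rw [map_windowProj π he Φ hs hp hB, diagonal_cutShift]
    refine ellTwo_ext fun m => ?_
    rw [cutShift_apply, lp.coeFn_smul, Pi.smul_apply, add_zero, Set.indicator_apply]
    rcases eq_or_ne m n with rfl | hmn
    · simp
    · have : (⟨m⟩ : ULift.{w} ℤ) ≠ ⟨n⟩ := by simpa using hmn
      simp [this]
  | zero => simp
  | add x y _ _ h1 h2 =>
    simp only [Set.mem_ofPred_eq] at h1 h2 ⊢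
    rw [map_add, add_apply, h1, h2, map_add, Pi.add_apply, add_smul]
  | smul r x _ h =>
    simp only [Set.mem_ofPred_eq] at h ⊢
    rw [map_smul, smul_apply, h, map_smul, Pi.smul_apply, smul_assoc]

theorem diagonal_map_mul (x : A) {y : A} (hy : y ∈ closure (windowSpan π he : Set A)) (n : ℤ) :
    diagonal (Φ (x * y)) n = diagonal (Φ x) n * diagonal (Φ y) n := by
  classical
  rw [diagonal_apply, map_mul, mul_apply_eq_comp, map_apply_single π he hs hp hy n, map_smul,
    lp.coeFn_smul, Pi.smul_apply, smul_eq_mul, mul_comm, ← diagonal_apply]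

variable [TopologicalSpace 𝓐] [DiscreteTopology 𝓐] [CompactSpace (orbitClosure ω)]

/-- Restriction to the orbit is isometric on a complete space, so its range is closed; it contains
each 1_B, as B comes from a clopen set. -/
theorem exists_restrictOrbit_eq {x : A} (hx : x ∈ closure (windowSpan π he : Set A)) :
    ∃ f, restrictOrbit ω f = boundedDiagonal (Φ x) := by
  have hcl : IsClosed ((fun x => boundedDiagonal (Φ x)) ⁻¹' Set.range (restrictOrbit ω)) :=
    (restrictOrbit ω).isometry.isClosedEmbedding.isClosed_range.preimage
      (continuous_boundedDiagonal.comp (continuous_starAlgHom Φ))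
  refine closure_minimal (fun y hy => ?_) hcl hx
  have hle : windowSpan π he ≤ (LinearMap.range (restrictOrbit ω).toLinearMap).comap
      (boundedDiagonal ∘ₗ (Φ : A →ₗ[ℂ] (EllTwo.{w} →L[ℂ] EllTwo.{w}))) := by
    refine Submodule.span_le.2 ?_
    rintro _ ⟨B, hB, rfl⟩
    obtain ⟨K, hK, h⟩ := exists_isClopen_of_mem_windowSets ω hB
    refine ⟨clopenIndicator ω hK, ?_⟩
    ext n
    change K.indicator 1 (orbitPoint ω n : ℤ → 𝓐) = diagonal (Φ _) n
    classical
    rw [map_windowProj π he Φ hs hp hB, diagonal_cutShift, Set.indicator_apply,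
      Set.indicator_apply, ← h n]
    rfl
  exact hle hy

variable {γ : Circle → A ≃⋆ₐ[ℂ] A} (hγs : ∀ z a, γ z (π.s a) = (z : ℂ) • π.s a)
  (hγp : ∀ z B, γ z (π.p B) = π.p B)
  (hgen : Dense (NonUnitalStarAlgebra.adjoin ℂ (Set.range π.s ∪ Set.range π.p) : Set A))
include hγs hγp hgen

/-- The gauge fixed-point algebra is isomorphic to the algebra of continuous functions on the
orbit closure. -/
theorem exists_starAlgEquiv {F : NonUnitalStarSubalgebra ℂ A}
    (hF : ∀ x, x ∈ F ↔ ∀ z, γ z x = x) :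
    ∃ ρ : F ≃⋆ₐ[ℂ] C(orbitClosure ω, ℂ), ∀ B ∈ windowSets ω,
      ∃ hm : windowProj π he B ∈ F, ∀ n, ρ ⟨_, hm⟩ (orbitPoint ω n) = B.indicator 1 n := by
  have hcl (x : F) : (x : A) ∈ closure (windowSpan π he : Set A) :=
    mem_closure_windowSpan_of_fixed π he hγs hγp hgen ((hF x).1 x.2)
  have hspan {x : A} (hx : x ∈ windowSpan π he) : x ∈ F :=
    (hF x).2 fun z => gauge_of_mem_windowSpan π he hγs hγp z hx
  -- The chosen function is unique, because the orbit is dense; hence every algebraic identity for ρ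
  -- can be checked on orbit points.
  choose ρ hρ using fun x : F => exists_restrictOrbit_eq π he hs hp (hcl x)
  have hρ' (x : F) (n : ℤ) : ρ x (orbitPoint ω n) = diagonal (Φ x) n := by
    rw [← restrictOrbit_apply, hρ, boundedDiagonal_apply]
  have hext {f g : C(orbitClosure ω, ℂ)} (h : ∀ n, f (orbitPoint ω n) = g (orbitPoint ω n)) :
      f = g := (restrictOrbit ω).injective (by ext n; exact h n)
  let ρh : F →⋆ₙₐ[ℂ] C(orbitClosure ω, ℂ) :=
    { toFun := ρ
      map_smul' := fun c x => hext fun n => by simp [hρ']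
      map_zero' := hext fun n => by simp [hρ']
      map_add' := fun x y => hext fun n => by simp [hρ']
      map_mul' := fun x y => hext fun n => by
        simp only [hρ', ContinuousMap.mul_apply]
        exact diagonal_map_mul π he hs hp _ (hcl y) n
      map_star' := fun x => hext fun n => by
        simp only [hρ', ContinuousMap.star_apply]
        rw [← diagonal_star, ← map_star]
        rfl }
  have hnorm (x : F) : ‖ρh x‖ = ‖x‖ := by
    change ‖ρ x‖ = _
    rw [← (restrictOrbit ω).norm_map, hρ]
    refine le_antisymm ?_ (norm_le_norm_boundedDiagonal π he hs hp (hcl x))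
    exact (norm_boundedDiagonal_le _).trans (NonUnitalStarAlgHom.norm_apply_le Φ (x : A))
  have hiso : Isometry ρh := AddMonoidHomClass.isometry_of_norm ρh hnorm
  have hFc : IsClosed (F : Set A) := by
    have : (F : Set A) = ⋂ z, {x | γ z x = x} := by
      ext x
      simp [hF]
    rw [this]
    exact isClosed_iInter fun z => isClosed_eq
      (AddMonoidHomClass.continuous_of_bound (γ z) 1 fun x => by
        simpa using NonUnitalStarAlgHom.norm_apply_le (γ z) x) continuous_id
  have : CompleteSpace F := hFc.completeSpace_coe
  have hval (B : Set ℤ) (hB : B ∈ windowSets ω) (n : ℤ) :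
      ρh ⟨_, hspan (windowProj_mem_windowSpan π he hB)⟩ (orbitPoint ω n) = B.indicator 1 n := by
    change ρ _ _ = _
    rw [hρ', map_windowProj π he Φ hs hp hB, diagonal_cutShift]
  -- Puts the constants in the range, as Stone–Weierstrass requires.
  have hone : ρh ⟨_, hspan (windowProj_mem_windowSpan π he univ_mem_windowSets)⟩ = 1 :=
    hext fun n => by rw [hval _ univ_mem_windowSets]; simp
  let R : StarSubalgebra ℂ C(orbitClosure ω, ℂ) :=
    { carrier := Set.range ρh
      mul_mem' := by rintro _ _ ⟨x, rfl⟩ ⟨y, rfl⟩; exact ⟨x * y, map_mul _ _ _⟩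
      add_mem' := by rintro _ _ ⟨x, rfl⟩ ⟨y, rfl⟩; exact ⟨x + y, map_add _ _ _⟩
      algebraMap_mem' := fun c => ⟨c • _, by
        rw [map_smul, hone, Algebra.algebraMap_eq_smul_one]⟩
      star_mem' := by rintro _ ⟨x, rfl⟩; exact ⟨star x, map_star _ _⟩ }
  -- Distinct points differ at some coordinate t, and the indicator of {v | v t = x t} is the image
  -- of a q_B.
  have hsep : R.SeparatesPoints := by
    intro x y hxy
    obtain ⟨t, ht⟩ := Function.ne_iff.1 fun h => hxy (Subtype.ext h)
    have hB := setOf_coord_mem_windowSets (ω := ω) t ((x : ℤ → 𝓐) t)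
    refine ⟨_, ⟨_, ⟨⟨_, hspan (windowProj_mem_windowSpan π he hB)⟩, rfl⟩, rfl⟩, ?_⟩
    have hKc : IsClopen ((fun v : ℤ → 𝓐 => v t) ⁻¹' {(x : ℤ → 𝓐) t}) :=
      (isClopen_discrete _).preimage (continuous_apply t)
    have : ρh ⟨_, hspan (windowProj_mem_windowSpan π he hB)⟩ = clopenIndicator ω hKc := by
      refine hext fun n => ?_
      classical
      rw [hval _ hB]
      change _ = Set.indicator _ 1 (orbitPoint ω n : ℤ → 𝓐)
      simp [Set.indicator_apply, orbitPoint_apply, add_comm]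
    rw [this]
    classical
    change Set.indicator _ 1 (x : ℤ → 𝓐) ≠ Set.indicator _ 1 (y : ℤ → 𝓐)
    simp [ht.symm]
  -- The range is dense by Stone–Weierstrass and closed because the map is isometric on a complete
  -- space.
  have hsurj : Function.Surjective ρh := by
    intro f
    have hR : IsClosed (R : Set C(orbitClosure ω, ℂ)) := hiso.isClosedEmbedding.isClosed_range
    have htop := ContinuousMap.starSubalgebra_topologicalClosure_eq_top_of_separatesPoints R hsep
    have hf : f ∈ R.topologicalClosure := htop ▸ StarSubalgebra.mem_top
    rw [← SetLike.mem_coe, StarSubalgebra.topologicalClosure_coe, hR.closure_eq] at hf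
    exact hf
  exact ⟨StarAlgEquiv.ofBijective ρh ⟨hiso.injective, hsurj⟩, fun B hB => ⟨_, hval B hB⟩⟩

end Fixed

/-! ### Generators and words in the universal algebra -/

section Universal

variable {𝓐 : Type u} [Fintype 𝓐] (ω : ℤ → 𝓐)

theorem dense_adjoin_universalRep :
    Dense (NonUnitalStarAlgebra.adjoin ℂ
      (Set.range (universalRep.{w} (sequenceGraph ω)).s ∪
        Set.range (universalRep.{w} (sequenceGraph ω)).p) : Set (CStar.{w} (sequenceGraph ω))) := by
  set G := sequenceGraph ω
  set D := NonUnitalStarAlgebra.adjoin ℂ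
    (Set.range (universalRep.{w} G).s ∪ Set.range (universalRep.{w} G).p)
  have key (x : BoundedFamilies.{w} G) (hx : x ∈ genAlgebra.{w} G) :
      (⟨x, (genAlgebra G).le_topologicalClosure hx⟩ : CStar.{w} G) ∈ D := by
    induction hx using NonUnitalStarAlgebra.adjoin_induction with
    | mem x hx =>
      rcases hx with ⟨a, rfl⟩ | ⟨A, rfl⟩
      · exact NonUnitalStarAlgebra.subset_adjoin ℂ _ (Or.inl ⟨a, rfl⟩)
      · exact NonUnitalStarAlgebra.subset_adjoin ℂ _ (Or.inr ⟨A, rfl⟩)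
    | add x y hx hy h1 h2 => exact add_mem h1 h2
    | zero => exact zero_mem D
    | mul x y hx hy h1 h2 => exact mul_mem h1 h2
    | smul r x hx h => exact D.smul_mem r h
    | star x hx h => exact star_mem h
  intro y
  rw [closure_subtype]
  have hsub : (genAlgebra.{w} G : Set (BoundedFamilies.{w} G)) ⊆
      Subtype.val '' (D : Set (CStar.{w} G)) := fun z hz => ⟨_, key z hz, rfl⟩
  exact closure_mono hsub y.2

variable {ω}

/-- Peel off the first letter and conjugate by one s_a at a time; membership in `windowSets` is
carried along because each conjugation needs it. -/
theorem uSWord_mul_windowProj_mul_star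
    (he : ∀ x, proj (universalRep.{w} (sequenceGraph ω)) Set.univ * x = x) {α : List 𝓐}
    (hα : α ≠ []) {C : Set ℤ} (hC : C ∈ windowSets ω) :
    {n : ℤ | ω ∈ cylinder n α ∧ n + α.length ∈ C} ∈ windowSets ω ∧
      (sequenceGraph ω).uSWord α * windowProj (universalRep (sequenceGraph ω)) he C *
        star ((sequenceGraph ω).uSWord α) =
      windowProj (universalRep (sequenceGraph ω)) he
        {n | ω ∈ cylinder n α ∧ n + α.length ∈ C} := by
  have hmem (a : 𝓐) {B : Set ℤ} (hB : B ∈ windowSets ω) :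
      {n : ℤ | ω n = a ∧ n + 1 ∈ B} ∈ windowSets ω := by
    have := inter_mem_windowSets (setOf_coord_mem_windowSets (ω := ω) 0 a)
      (intTranslate_mem_windowSets hB (-1))
    convert this using 1
    ext n
    simp
  induction α with
  | nil => exact absurd rfl hα
  | cons a α ih =>
    cases α with
    -- The induction really starts at one letter: for the empty word `uSWord` has the dummy value 0.
    | nil =>
      have hS : {n : ℤ | ω ∈ cylinder n [a] ∧ n + ([a].length : ℤ) ∈ C} =
          {n | ω n = a ∧ n + 1 ∈ C} := by
        ext n
        simp [mem_cylinder_singleton]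
      rw [hS]
      exact ⟨hmem a hC, s_mul_windowProj_mul_star_s (universalRep (sequenceGraph ω)) he hC a⟩
    | cons b α =>
      obtain ⟨h1, h2⟩ := ih (List.cons_ne_nil b α)
      have hS : {n : ℤ | ω ∈ cylinder n (a :: b :: α) ∧ n + ((a :: b :: α).length : ℤ) ∈ C} =
          {n | ω n = a ∧
            n + 1 ∈ {n : ℤ | ω ∈ cylinder n (b :: α) ∧ n + ((b :: α).length : ℤ) ∈ C}} := by
        ext n
        simp only [Set.mem_ofPred_eq, mem_cylinder_cons (α := b :: α), and_assoc,
          List.length_cons (a := a), Nat.cast_succ]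
        rw [show n + 1 + ((b :: α).length : ℤ) = n + ((b :: α).length + 1) by ring]
      rw [hS]
      refine ⟨hmem a h1, ?_⟩
      rw [← s_mul_windowProj_mul_star_s (universalRep (sequenceGraph ω)) he h1 a, ← h2, uSWord,
        star_mul]
      simp only [mul_assoc]
      rfl

end Universal

end SequenceGraph

open SequenceGraph LabeledGraph in
/-- The gauge fixed-point algebra of `C*(E_ℤ, ℒ_ω, Ē_ℤ)` is ⋆-isomorphic to `C(𝒪_ω)` by a map that
sends `s_α p_{r(α'α)} s_α*` to the characteristic function of `[α'.α]`. -/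
theorem proposition3p2 {𝓐 : Type u} [Fintype 𝓐] [TopologicalSpace 𝓐] [DiscreteTopology 𝓐]
    (hcard : 2 ≤ Fintype.card 𝓐) (ω : ℤ → 𝓐)
    (hω : IsCantorMinimalSubshift (orbitClosure ω)) :
    ∃ ρ : LabeledGraph.gaugeFixed.{w} (sequenceGraph ω) ≃⋆ₐ[ℂ] C(orbitClosure ω, ℂ),
      ∀ (α : List 𝓐) (hα : α ∈ (sequenceGraph ω).labeledPaths),
        ∀ α' ∈ (sequenceGraph ω).labeledPaths,
          ∃ hmem : (sequenceGraph ω).uSWord α *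
              (sequenceGraph ω).uP ⟨(sequenceGraph ω).range (α' ++ α),
                (sequenceGraph ω).range_mem_Ebar (List.append_ne_nil_of_right_ne_nil α' hα.1)⟩ *
              star ((sequenceGraph ω).uSWord α) ∈ LabeledGraph.gaugeFixed.{w} (sequenceGraph ω),
            ∀ x : orbitClosure ω,
              ρ ⟨_, hmem⟩ x = (dotCylinder α' α).indicator (fun _ => (1 : ℂ)) (x : ℤ → 𝓐) := by
  have : CompactSpace (orbitClosure ω) := hω.isCantorSpace.compact
  have hgen := dense_adjoin_universalRep.{u, w} ω
  have he := proj_univ_mul_of_dense _ hgen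
  -- The universal property applies only to algebras in universe `w`, whence the lifted index set of
  -- `EllTwo`.
  obtain ⟨Φ, ⟨hs, hp⟩, -⟩ := existsUnique_lift (sequenceGraph ω) (regularRep.{u, w} ω)
  obtain ⟨ρ, hρ⟩ := exists_starAlgEquiv (universalRep (sequenceGraph ω)) he (Φ := Φ) hs hp
    (γ := gauge (sequenceGraph ω)) (gauge_uS _) (gauge_uP _) hgen
    (F := gaugeFixed (sequenceGraph ω)) fun x => Iff.rfl
  refine ⟨ρ, fun α hα α' hα' => ?_⟩
  have hr := (sequenceGraph ω).range_mem_Ebar (List.append_ne_nil_of_right_ne_nil α' hα.1)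
  obtain ⟨hB, heq⟩ := uSWord_mul_windowProj_mul_star he hα.1 (mem_windowSets_of_mem_Ebar hr)
  rw [windowProj_of_mem_Ebar _ he hr, proj_of_mem _ hr] at heq
  obtain ⟨hm, hval⟩ := hρ _ hB
  have heq' : (sequenceGraph ω).uSWord α *
      (sequenceGraph ω).uP ⟨(sequenceGraph ω).range (α' ++ α), hr⟩ *
      star ((sequenceGraph ω).uSWord α) = _ := heq
  refine ⟨heq' ▸ hm, fun x => ?_⟩
  have hK : IsClopen (dotCylinder α' α : Set (ℤ → 𝓐)) := isClopen_cylinder _ _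
  have hfun : ρ ⟨_, heq' ▸ hm⟩ = clopenIndicator ω hK := by
    refine (restrictOrbit ω).injective ?_
    ext n
    rw [restrictOrbit_apply, restrictOrbit_apply]
    have h1 : (⟨_, heq' ▸ hm⟩ : gaugeFixed.{w} (sequenceGraph ω)) = ⟨_, hm⟩ := Subtype.ext heq'
    rw [h1, hval n]
    change _ = Set.indicator _ 1 (orbitPoint ω n : ℤ → 𝓐)
    classical
    rw [Set.indicator_apply, Set.indicator_apply]
    congr 1
    rw [dotCylinder, orbitPoint_mem_cylinder]
    -- The vertex n + |α| lies in r(α'α) exactly when ω reads α'α from n - |α'| on; this already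
    -- contains the condition that ω reads α from n on.
    simp only [Set.mem_ofPred_eq, SequenceGraph.mem_range, mem_cylinder_append,
      List.length_append, Nat.cast_add, eq_iff_iff]
    rw [show n + (α.length : ℤ) - (α'.length + α.length) = -α'.length + n by ring,
      show -(α'.length : ℤ) + n + α'.length = n by ring]
    tauto
  rw [hfun]
  rfl
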